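/- Let $K$ be a field, $q\in K$, and $[n]_q=1+q+\cdots+q^{n-1}$ for integers $n\ge 0$ (so $[n]_q=(1-q^n)/(1-q)$ if $q\neq 1$, and $[0]_q=0$). Let $N>0$ be an integer such that $[n]_q\neq 0$ for $0<n<N$. Let $D$ be a skew Young diagram with boxes $(i,j)$ in row $i$ and column $j$ (English notation), and let $\boldsymbol{k}=(k_{ij})_{(i,j)\in D}$ be a family of positive integers that is diagonally constant, i.e. $k_{ij}$ depends only on $i-j$. For $p\in\mathbb{Z}$ put $D_p=\{(i,j)\in D \mid i-j=p\}$ and $J_p=\{j \mid (j+p,j)\in D_p\}$, and let $k_p$ be the common value of $k_{ij}$ on $D_p$ if $D_p\neq\varnothing$. Define $$\zeta^{BZ}_{<N}(\boldsymbol{k})=\sum_{(m_{ij})}\ \prod_{(i,j)\in D}\frac{q^{(k_{ij}-1)m_{ij}}}{[m_{ij}]_q^{k_{ij}}},$$ where $(m_{ij})$ runs over the semistandard Young tableaux on $D$ (rows weakly increasing from left to right, columns strictly increasing from top to bottom) with entries in $\{1,\dots,N-1\}$. For finite sets $J,J'$ of integers and integer tuples $\boldsymbol{m}=(m_j)_{j\in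 J}$, $\boldsymbol{n}=(n_j)_{j\in J'}$, write $\boldsymbol{m}\vartriangleleft\boldsymbol{n}$ if $m_j<n_j$ whenever $j\in J\cap J'$ and $n_{j-1}\le m_j$ whenever $j\in J$, $j-1\in J'$; write $\boldsymbol{m}\trianglelefteq\boldsymbol{n}$ if $m_j\le n_j$ whenever $j\in J\cap J'$ and $n_{j-1}<m_j$ whenever $j\in J$, $j-1\in J'$. Define $$\zeta^{q\flat}_{<N}(\boldsymbol{k})=\sum_{(\boldsymbol{n}_p^{(l)})}\ \prod_{p:\,D_p\neq\varnothing}\ \prod_{j\in J_p}\left(\frac{1}{[N-n^{(1)}_{p,j}]_q}\prod_{l=2}^{k_p}\frac{q^{n^{(l)}_{p,j}}}{[n^{(l)}_{p,j}]_q}\right),$$ where the sum runs over all families of tuples $\boldsymbol{n}_p^{(l)}=(n^{(l)}_{p,j})_{j\in J_p}\in\{1,\dots,N-1\}^{J_p}$ ($D_p\ne\varnothing$, $1\le l\le k_p$) such that $\boldsymbol{n}_p^{(l)}\trianglelefteq\boldsymbol{n}_p^{(l+1)}$ whenever $1\le l<k_p$, and $\boldsymbol{n}_p^{(k_p)}\vartriangleleft\boldsymbol{n}_{p+1}^{(1)}$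 whenever $D_p$ and $D_{p+1}$ are both non-empty. Then $$\zeta^{BZ}_{<N}(\boldsymbol{k})=\zeta^{q\flat}_{<N}(\boldsymbol{k}).$$ -/

import Mathlib

namespace SchurMSW

/-- The `q`-integer `[n]_q = 1 + q + ⋯ + q^(n-1)`; see `qInt_eq_div` for `q ≠ 1`. -/
def qInt {K : Type*} [Field K] (q : K) (n : ℕ) : K := ∑ i ∈ Finset.range n, q ^ i

theorem qInt_eq_div {K : Type*} [Field K] {q : K} (hq : q ≠ 1) (n : ℕ) :
    qInt q n = (1 - q ^ n) / (1 - q) := by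
  rw [qInt, geom_sum_eq hq, ← neg_sub (1 : K) q, ← neg_sub (1 : K) (q ^ n), neg_div_neg_eq]

/-- A skew Young diagram, given by Young diagrams `inner ⊆ outer` (English notation, with boxes
`(i, j) = (row, column)`). It may be empty or disconnected. -/
structure SkewYoungDiagram where
  outer : YoungDiagram
  inner : YoungDiagram
  inner_le_outer : inner ≤ outer

namespace SkewYoungDiagram

/-- The boxes of the skew diagram: those of `outer` that are not in `inner`. -/
def cells (D : SkewYoungDiagram) : Finset (ℕ × ℕ) := D.outer.cells \ D.inner.cells

/-- The content `i - j` of a box `(i, j)`. -/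
def content (c : ℕ × ℕ) : ℤ := (c.1 : ℤ) - (c.2 : ℤ)

/-- The contents of the boxes of `D`, i.e. the `p` for which the diagonal `D_p` is not empty. -/
def contents (D : SkewYoungDiagram) : Finset ℤ := D.cells.image content

/-- The diagonal `D_p = {(i, j) ∈ D | i - j = p}`. -/
def diagonal (D : SkewYoungDiagram) (p : ℤ) : Finset (ℕ × ℕ) :=
  D.cells.filter fun c => content c = p

/-- `J_p = {j | (j + p, j) ∈ D_p}`, the set of columns met by the diagonal `D_p`. -/
def J (D : SkewYoungDiagram) (p : ℤ) : Finset ℕ := (D.diagonal p).image Prod.snd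

theorem mem_J {D : SkewYoungDiagram} {p : ℤ} {j : ℕ} :
    j ∈ D.J p ↔ ∃ i : ℕ, (i, j) ∈ D.cells ∧ (i : ℤ) = j + p := by
  simp only [J, diagonal, Finset.mem_image, Finset.mem_filter]
  constructor
  · rintro ⟨⟨i, j'⟩, ⟨h, hp⟩, rfl⟩
    exact ⟨i, h, by simp only [content] at hp ⊢; omega⟩
  · rintro ⟨i, h, hp⟩
    exact ⟨(i, j), ⟨h, by simp only [content]; omega⟩, rfl⟩

/-- `T` is semistandard on `D`: rows weakly increase from left to right and columns strictly
increase from top to bottom. -/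
def IsSemistandard (D : SkewYoungDiagram) (T : ℕ × ℕ → ℕ) : Prop :=
  (∀ i j j' : ℕ, j < j' → (i, j) ∈ D.cells → (i, j') ∈ D.cells → T (i, j) ≤ T (i, j')) ∧
  (∀ i i' j : ℕ, i < i' → (i, j) ∈ D.cells → (i', j) ∈ D.cells → T (i, j) < T (i', j))

open Classical in
/-- The semistandard tableaux on `D` with entries in `{1, …, N - 1}`
(a tableau is extended by `0` outside `D`). -/
noncomputable def ssyt (D : SkewYoungDiagram) (N : ℕ) : Finset (ℕ × ℕ →₀ ℕ) :=
  (D.cells.finsupp fun _ => Finset.Icc 1 (N - 1)).filter fun T => D.IsSemistandard T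

theorem mem_ssyt {D : SkewYoungDiagram} {N : ℕ} {T : ℕ × ℕ →₀ ℕ} :
    T ∈ D.ssyt N ↔ (T.support ⊆ D.cells ∧ ∀ c ∈ D.cells, T c ∈ Finset.Icc 1 (N - 1)) ∧
      D.IsSemistandard T := by
  classical
  simp only [ssyt, Finset.mem_filter, Finset.mem_finsupp_iff]

/-- `k` is an index on `D`: a positive integer is attached to every box of `D`. -/
def IsIndex (D : SkewYoungDiagram) (k : ℕ × ℕ → ℕ) : Prop := ∀ c ∈ D.cells, 0 < k c

/-- `k` is diagonally constant on `D`: `k (i, j)` depends only on `i - j` for `(i, j) ∈ D`. -/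
def IsDiagonallyConstant (D : SkewYoungDiagram) (k : ℕ × ℕ → ℕ) : Prop :=
  ∀ c ∈ D.cells, ∀ c' ∈ D.cells, content c = content c' → k c = k c'

/-- The common value `k_p` of a diagonally constant `k` on the diagonal `D_p`
(and `0` if `D_p` is empty). -/
def diagValue (D : SkewYoungDiagram) (k : ℕ × ℕ → ℕ) (p : ℤ) : ℕ := (D.diagonal p).sup k

theorem diagValue_content {D : SkewYoungDiagram} {k : ℕ × ℕ → ℕ} (hk : D.IsDiagonallyConstant k)
    {c : ℕ × ℕ} (hc : c ∈ D.cells) : D.diagValue k (content c) = k c := by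
  apply le_antisymm
  · refine Finset.sup_le fun c' hc' => ?_
    rw [diagonal, Finset.mem_filter] at hc'
    exact (hk c' hc'.1 c hc hc'.2).le
  · exact Finset.le_sup (f := k) (Finset.mem_filter.2 ⟨hc, rfl⟩)

end SkewYoungDiagram

/-- The relation `m ◁ n` between tuples `m = (m_j)_{j ∈ J}` and `n = (n_j)_{j ∈ J'}`:
`m_j < n_j` if `j ∈ J` and `j ∈ J'`, and `n_{j-1} ≤ m_j` if `j ∈ J` and `j - 1 ∈ J'`. -/
def StrictRel (J J' : Finset ℕ) (m n : ℕ → ℕ) : Prop :=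
  (∀ j, j ∈ J → j ∈ J' → m j < n j) ∧ (∀ j, j + 1 ∈ J → j ∈ J' → n j ≤ m (j + 1))

/-- The relation `m ⊴ n` between tuples `m = (m_j)_{j ∈ J}` and `n = (n_j)_{j ∈ J'}`:
`m_j ≤ n_j` if `j ∈ J` and `j ∈ J'`, and `n_{j-1} < m_j` if `j ∈ J` and `j - 1 ∈ J'`. -/
def WeakRel (J J' : Finset ℕ) (m n : ℕ → ℕ) : Prop :=
  (∀ j, j ∈ J → j ∈ J' → m j ≤ n j) ∧ (∀ j, j + 1 ∈ J → j ∈ J' → n j < m (j + 1))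

/-- The index set of the summation variables of the `q♭`-sum: the `(p, l, j)` with `D_p` not empty,
`1 ≤ l ≤ k_p` and `j ∈ J_p`. -/
def flatSupport (D : SkewYoungDiagram) (k : ℕ × ℕ → ℕ) : Finset (ℤ × ℕ × ℕ) :=
  D.contents.biUnion fun p => {p} ×ˢ Finset.Icc 1 (D.diagValue k p) ×ˢ D.J p

/-- The tuple `n_p^(l) = (j ↦ n (p, l, j))`. -/
def tuple (n : ℤ × ℕ × ℕ → ℕ) (p : ℤ) (l : ℕ) : ℕ → ℕ := fun j => n (p, l, j)

/-- The summation conditions of the `q♭`-sum: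
`n_p^(l) ⊴ n_p^(l+1)` for `1 ≤ l < k_p`, and `n_p^(k_p) ◁ n_{p+1}^(1)`
(the conditions are empty for the `p` where a diagonal involved is empty). -/
def IsFlatAdmissible (D : SkewYoungDiagram) (k : ℕ × ℕ → ℕ) (n : ℤ × ℕ × ℕ → ℕ) : Prop :=
  (∀ (p : ℤ) (l : ℕ), 1 ≤ l → l < D.diagValue k p →
    WeakRel (D.J p) (D.J p) (tuple n p l) (tuple n p (l + 1))) ∧
  (∀ p : ℤ, StrictRel (D.J p) (D.J (p + 1)) (tuple n p (D.diagValue k p)) (tuple n (p + 1) 1))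

open Classical in
/-- The families `(n_p^(l))` with entries in `{1, …, N - 1}` over which the `q♭`-sum runs
(a family is extended by `0` outside `flatSupport D k`). -/
noncomputable def flatFamilies (D : SkewYoungDiagram) (k : ℕ × ℕ → ℕ) (N : ℕ) :
    Finset (ℤ × ℕ × ℕ →₀ ℕ) :=
  ((flatSupport D k).finsupp fun _ => Finset.Icc 1 (N - 1)).filter fun n => IsFlatAdmissible D k n

theorem mem_flatFamilies {D : SkewYoungDiagram} {k : ℕ × ℕ → ℕ} {N : ℕ} {n : ℤ × ℕ × ℕ →₀ ℕ} :
    n ∈ flatFamilies D k N ↔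
      (n.support ⊆ flatSupport D k ∧ ∀ x ∈ flatSupport D k, n x ∈ Finset.Icc 1 (N - 1)) ∧
        IsFlatAdmissible D k n := by
  classical
  simp only [flatFamilies, Finset.mem_filter, Finset.mem_finsupp_iff]

/-- The Schur type multiple harmonic `q`-sum of Bradley-Zhao model. -/
noncomputable def zetaBZ {K : Type*} [Field K] (q : K) (D : SkewYoungDiagram) (k : ℕ × ℕ → ℕ)
    (N : ℕ) : K :=
  ∑ T ∈ D.ssyt N, ∏ c ∈ D.cells, q ^ ((k c - 1) * T c) / qInt q (T c) ^ k c

/-- The Schur type `q♭`-sum. -/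
noncomputable def zetaFlat {K : Type*} [Field K] (q : K) (D : SkewYoungDiagram) (k : ℕ × ℕ → ℕ)
    (N : ℕ) : K :=
  ∑ n ∈ flatFamilies D k N, ∏ p ∈ D.contents,
    ((∏ j ∈ D.J p, 1 / qInt q (N - tuple n p 1 j)) *
      ∏ l ∈ Finset.Icc 2 (D.diagValue k p), ∏ j ∈ D.J p,
        q ^ tuple n p l j / qInt q (tuple n p l j))

end SchurMSW

/-!
The sums are transported into each other by a connected sum whose connector is a determinant.

For a single variable, the connector `C(m, n)` is the quotient of the `q`-binomial coefficients
`[n choose m]` and `[N - 1 choose m]`. It satisfies two telescoping relations,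

* `∑_{l < z ≤ h} q^z / [z] · C(m, z) = q^m / [m] · (C(m, h) - C(m, l))` (`sum_weight_connector`),
* `∑_{l < x ≤ u} 1 / [x] · (C(x, b) - C(x, a)) =
    ∑_{a < z ≤ b} 1 / [N - z] · (C(l, z - 1) - C(u, z - 1))` (`sum_inv_connector`),

which trade a summation over an entry of the tableau for summations over variables of the
`q♭`-sum. On a diagonal with several boxes one takes determinants of differences of connectors.
By multilinearity, a sum over all tuples in a product of intervals of such a determinant is again
such a determinant; and the relations `◁` and `⊴` to a given weakly increasing tuple say precisely
that each entry lies in an interval whose ends are neighbouring entries of that tuple. The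
thresholds on both sides are brought into line by subtracting neighbouring rows or columns, which
does not change a determinant (`detOn_row_sub_succ`, `detOn_col_sub_pred`). The diagonals `D_p`
and `D_{p+1}` may differ at either end; there the value `0` for a missing row and `N - 1` for a
missing column lead to connectors equal to `1`, and both descriptions of the kernel `transfer`
from `D_p` to `D_{p+1}`, by differences of columns and by differences of rows, reduce to one
determinant on an interval that contains `J_p` and `J_{p+1}` (`transfer_eq`).

`sum_transfer_mul_chainSum` moves the kernel across one diagonal: the `k_p - 1` factors `q^m / [m]`
of each entry produce the tuples `n_p^(2), …, n_p^(k_p)`, and the last factor `1 / [m]` produces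
`n_p^(1)`. A semistandard tableau is a sequence of tuples on the diagonals with
`m_p ◁ m_{p+1}` (`isSemistandard_iff`), so both sums are transfer matrix products over the
diagonals (`chainSum`), and the induction from the largest content downwards
(`chainSum_tableauKernel`) turns the one into the other.
-/

namespace SchurMSW

/-! ### Sums over families of integers organized in layers -/

section Layers

variable {K : Type*} [CommRing K] {α β : Type*} [DecidableEq α] [DecidableEq β]

omit [DecidableEq α] in
theorem sum_finsupp_prod (s : Finset α) (t : α → Finset ℕ) (f : α → ℕ → K) :
    ∑ x ∈ s.finsupp t, ∏ a ∈ s, f a (x a) = ∏ a ∈ s, ∑ b ∈ t a, f a b := by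
  classical
  rw [Finset.prod_sum, Finset.finsupp, Finset.sum_map]
  refine Finset.sum_congr rfl fun p _ => ?_
  rw [← Finset.prod_attach]
  refine Finset.prod_congr rfl fun a _ => ?_
  simp

/-- The set of pairs `(a, b)` with `a ∈ S` and `b ∈ X a`: the variables of the layers in `S`. -/
def layers (X : α → Finset β) (S : Finset α) : Finset (α × β) :=
  S.biUnion fun a => {a} ×ˢ X a

theorem mem_layers {X : α → Finset β} {S : Finset α} {c : α × β} :
    c ∈ layers X S ↔ c.1 ∈ S ∧ c.2 ∈ X c.1 := by
  simp only [layers, Finset.mem_biUnion, Finset.mem_product, Finset.mem_singleton]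
  constructor
  · rintro ⟨a, ha, h, h'⟩
    subst h
    exact ⟨ha, h'⟩
  · rintro ⟨h, h'⟩
    exact ⟨c.1, h, rfl, h'⟩

omit [DecidableEq α] in
theorem eq_zero_of_support_subset {s : Finset α} {f : α →₀ ℕ} {c : α} (hf : f.support ⊆ s)
    (hc : c ∉ s) : f c = 0 := by
  by_contra h
  exact hc (hf (Finsupp.mem_support_iff.2 h))

/-- A sum over families on several layers splits off the sum over the values on one layer. -/
theorem sum_layers_insert (V : Finset ℕ) (X : α → Finset β) {a : α} {S : Finset α} (ha : a ∉ S)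
    (F : (α × β → ℕ) → K) :
    ∑ f ∈ (layers X (insert a S)).finsupp (fun _ => V), F f =
      ∑ x ∈ (X a).finsupp (fun _ => V), ∑ g ∈ (layers X S).finsupp (fun _ => V),
        F (fun c => if c.1 = a then x c.2 else g c) := by
  rw [← Finset.sum_product']
  refine Finset.sum_bij'
    (fun f _ => (Finsupp.indicator (X a) fun b _ => f (a, b),
      Finsupp.indicator (layers X S) fun c _ => f c))
    (fun y _ => Finsupp.indicator (layers X (insert a S))
      fun c _ => if c.1 = a then y.1 c.2 else y.2 c) ?_ ?_ ?_ ?_ ?_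
  · intro f hf
    rw [Finset.mem_finsupp_iff] at hf
    simp only [Finset.mem_product, Finset.mem_finsupp_iff]
    refine ⟨⟨Finsupp.support_indicator_subset _ _, fun b hb => ?_⟩,
      Finsupp.support_indicator_subset _ _, fun c hc => ?_⟩
    · rw [Finsupp.indicator_of_mem hb]
      exact hf.2 _ (mem_layers.2 ⟨Finset.mem_insert_self _ _, hb⟩)
    · rw [Finsupp.indicator_of_mem hc]
      rw [mem_layers] at hc
      exact hf.2 _ (mem_layers.2 ⟨Finset.mem_insert_of_mem hc.1, hc.2⟩)
  · rintro ⟨x, g⟩ hy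
    simp only [Finset.mem_product, Finset.mem_finsupp_iff] at hy ⊢
    refine ⟨Finsupp.support_indicator_subset _ _, fun c hc => ?_⟩
    rw [Finsupp.indicator_of_mem hc]
    rw [mem_layers, Finset.mem_insert] at hc
    split_ifs with h
    · exact hy.1.2 _ (h ▸ hc.2)
    · exact hy.2.2 _ (mem_layers.2 ⟨hc.1.resolve_left h, hc.2⟩)
  · intro f hf
    rw [Finset.mem_finsupp_iff] at hf
    ext c
    simp only [Finsupp.indicator_apply, mem_layers, Finset.mem_insert]
    by_cases hc : c ∈ layers X (insert a S)
    · rw [mem_layers, Finset.mem_insert] at hc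
      rcases c with ⟨c, b⟩
      by_cases h : c = a
      · subst h
        simp_all
      · simp_all
    · rw [eq_zero_of_support_subset hf.1 hc]
      rw [mem_layers, Finset.mem_insert] at hc
      simp [hc]
  · rintro ⟨x, g⟩ hy
    simp only [Finset.mem_product, Finset.mem_finsupp_iff] at hy
    ext c
    · by_cases hc : c ∈ X a
      · simp [Finsupp.indicator_apply, mem_layers, hc]
      · simp [Finsupp.indicator_apply, hc, eq_zero_of_support_subset hy.1.1 hc]
    · by_cases hc : c ∈ layers X S
      · have hc' := mem_layers.1 hc
        have : c.1 ≠ a := fun h => ha (h ▸ hc'.1)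
        simp [Finsupp.indicator_apply, mem_layers, hc', this]
      · simp [Finsupp.indicator_apply, hc, eq_zero_of_support_subset hy.2.1 hc]
  · intro f hf
    rw [Finset.mem_finsupp_iff] at hf
    congr 1
    funext c
    simp only [Finsupp.indicator_apply]
    by_cases hc : c ∈ layers X (insert a S)
    · rw [mem_layers, Finset.mem_insert] at hc
      rcases c with ⟨c, b⟩
      by_cases h : c = a
      · subst h
        simp_all
      · simp_all [mem_layers]
    · rw [eq_zero_of_support_subset hf.1 hc]
      rw [mem_layers, Finset.mem_insert] at hc
      rcases c with ⟨c, b⟩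
      by_cases h : c = a
      · subst h
        simp_all
      · simp_all [mem_layers]

/-- The transfer matrix form of a sum over the layers `e (t + 1), …, e (t + L)`, given the values
`x` on the layer `e t`: the kernel `Φ a` couples the layer `a` to the next one, and the layer
after the last one carries the values `0`. -/
noncomputable def chainSum (V : Finset ℕ) (X : α → Finset β) (Φ : α → (β → ℕ) → (β → ℕ) → K)
    (e : ℕ → α) : ℕ → ℕ → (β → ℕ) → K
  | 0, t, x => Φ (e t) x 0
  | L + 1, t, x => ∑ y ∈ (X (e (t + 1))).finsupp (fun _ => V),
      Φ (e t) x y * chainSum V X Φ e L (t + 1) y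

/-- The transfer matrix product is the sum over all families of values on the layers. -/
theorem chainSum_eq_sum (V : Finset ℕ) (X : α → Finset β) (Φ : α → (β → ℕ) → (β → ℕ) → K)
    {e : ℕ → α} (he : Function.Injective e) (L t : ℕ) (x : β → ℕ) :
    chainSum V X Φ e L t x =
      ∑ g ∈ (layers X ((Finset.Ico (t + 1) (t + 1 + L)).image e)).finsupp (fun _ => V),
        Φ (e t) x (Function.curry g (e (t + 1))) * ∏ s ∈ Finset.Ico (t + 1) (t + 1 + L),
          Φ (e s) (Function.curry g (e s)) (Function.curry g (e (s + 1))) := by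
  induction L generalizing t x with
  | zero =>
    have h : (layers X ((Finset.Ico (t + 1) (t + 1 + 0)).image e)).finsupp (fun _ => V) = {0} := by
      ext f
      simp [Finset.mem_finsupp_iff, layers]
    rw [h, Finset.sum_singleton]
    simp [chainSum]
    rfl
  | succ L ih =>
    have hI : Finset.Ico (t + 1) (t + 1 + (L + 1)) =
        insert (t + 1) (Finset.Ico (t + 1 + 1) (t + 1 + 1 + L)) := by
      ext; simp only [Finset.mem_Ico, Finset.mem_insert]; omega
    have hn : t + 1 ∉ Finset.Ico (t + 1 + 1) (t + 1 + 1 + L) := by simp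
    have hn' : e (t + 1) ∉ (Finset.Ico (t + 1 + 1) (t + 1 + 1 + L)).image e := by
      rw [Finset.mem_image]
      rintro ⟨s, hs, h⟩
      exact hn (he h ▸ hs)
    rw [chainSum, hI, Finset.image_insert]
    simp only [Finset.prod_insert hn]
    rw [sum_layers_insert V X hn' (fun g => Φ (e t) x (Function.curry g (e (t + 1))) *
      (Φ (e (t + 1)) (Function.curry g (e (t + 1))) (Function.curry g (e (t + 1 + 1))) *
        ∏ s ∈ Finset.Ico (t + 1 + 1) (t + 1 + 1 + L),
          Φ (e s) (Function.curry g (e s)) (Function.curry g (e (s + 1)))))]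
    refine Finset.sum_congr rfl fun y _ => ?_
    rw [ih, Finset.mul_sum]
    refine Finset.sum_congr rfl fun g _ => ?_
    have h1 : ∀ s, t + 1 < s → Function.curry
        (fun c : α × β => if c.1 = e (t + 1) then y c.2 else g c) (e s) =
          Function.curry g (e s) := by
      intro s hs
      funext b
      have : e s ≠ e (t + 1) := fun h => absurd (he h) (by omega)
      simp [Function.curry, this]
    have h2 : Function.curry (fun c : α × β => if c.1 = e (t + 1) then y c.2 else g c) (e (t + 1))
        = y := by
      funext b
      simp [Function.curry]
    rw [h2, h1 _ (Nat.lt_succ_self _)]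
    congr 2
    refine Finset.prod_congr rfl fun s hs => ?_
    rw [Finset.mem_Ico] at hs
    rw [h1 s (by omega), h1 (s + 1) (by omega)]

omit [DecidableEq α] [DecidableEq β] in
theorem chainSum_eq_zero {V : Finset ℕ} {X : α → Finset β} {Φ : α → (β → ℕ) → (β → ℕ) → K}
    {e : ℕ → α} {t : ℕ} {x : β → ℕ} (h : ∀ y, Φ (e t) x y = 0) (L : ℕ) :
    chainSum V X Φ e L t x = 0 := by
  cases L with
  | zero => exact h 0
  | succ L => exact Finset.sum_eq_zero fun y _ => by rw [h, zero_mul]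

end Layers

/-! ### Determinants indexed by finite sets of integers -/

section Determinants

variable {K : Type*} [CommRing K]

/-- The determinant of `(f i j)` for `i, j ∈ J`. -/
def detOn (J : Finset ℕ) (f : ℕ → ℕ → K) : K := (Matrix.of fun i j : J => f i j).det

theorem detOn_congr {J : Finset ℕ} {f g : ℕ → ℕ → K} (h : ∀ i ∈ J, ∀ j ∈ J, f i j = g i j) :
    detOn J f = detOn J g := by
  unfold detOn
  congr 1
  ext i j
  exact h i i.2 j j.2

theorem detOn_empty (f : ℕ → ℕ → K) : detOn ∅ f = 1 := by
  simp [detOn]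

theorem detOn_transpose (J : Finset ℕ) (f : ℕ → ℕ → K) :
    detOn J (fun i j => f j i) = detOn J f := by
  unfold detOn
  rw [← Matrix.det_transpose]
  rfl

/-- Subtracting from each row its successor is the multiplication by an upper unitriangular
matrix. -/
theorem detOn_row_sub_succ (J : Finset ℕ) (f : ℕ → ℕ → K) :
    detOn J (fun i j => f i j - if i + 1 ∈ J then f (i + 1) j else 0) = detOn J f := by
  let U : Matrix J J K := Matrix.of fun i k => (if i = k then 1 else 0) -
    if (i : ℕ) + 1 = k then 1 else 0
  have hU : U.det = 1 := by
    rw [Matrix.det_of_isUpperTriangular]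
    · simp [U]
    · intro i j hij
      have hij : (j : ℕ) < i := hij
      have h1 : i ≠ j := fun h => by simp [h] at hij
      have h2 : (i : ℕ) + 1 ≠ j := by omega
      simp [U, h1, h2]
  have hM : (Matrix.of fun i j : J => f i j - if (i : ℕ) + 1 ∈ J then f (i + 1) j else 0) =
      U * Matrix.of fun i j : J => f i j := by
    ext i j
    simp only [U, Matrix.mul_apply, Matrix.of_apply, sub_mul, ite_mul, one_mul, zero_mul,
      Finset.sum_sub_distrib, Finset.sum_ite_eq, Finset.mem_univ, if_true]
    congr 1
    rw [Finset.sum_coe_sort J fun k => if (i : ℕ) + 1 = k then f k j else 0, Finset.sum_ite_eq]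
  rw [detOn, hM, Matrix.det_mul, hU, one_mul, detOn]

theorem detOn_col_sub_pred (J : Finset ℕ) (f : ℕ → ℕ → K) :
    detOn J (fun i j => f i j - if 1 ≤ j ∧ j - 1 ∈ J then f i (j - 1) else 0) = detOn J f := by
  let U : Matrix J J K := Matrix.of fun k j => (if k = j then 1 else 0) -
    if (k : ℕ) + 1 = j then 1 else 0
  have hU : U.det = 1 := by
    rw [Matrix.det_of_isUpperTriangular]
    · simp [U]
    · intro i j hij
      have hij : (j : ℕ) < i := hij
      have h1 : i ≠ j := fun h => by simp [h] at hij
      have h2 : (i : ℕ) + 1 ≠ j := by omega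
      simp [U, h1, h2]
  have hM : (Matrix.of fun i j : J => f i j -
      if 1 ≤ (j : ℕ) ∧ (j : ℕ) - 1 ∈ J then f i (j - 1) else 0) =
      (Matrix.of fun i j : J => f i j) * U := by
    ext i j
    simp only [U, Matrix.mul_apply, Matrix.of_apply, mul_sub, mul_ite, mul_one, mul_zero,
      Finset.sum_sub_distrib, Finset.sum_ite_eq', Finset.mem_univ, if_true]
    congr 1
    rw [Finset.sum_coe_sort J fun k => if k + 1 = (j : ℕ) then f i k else 0]
    rcases Nat.eq_zero_or_pos (j : ℕ) with h | h
    · simp [h]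
    · have : ∀ k, k + 1 = (j : ℕ) ↔ (j : ℕ) - 1 = k := by omega
      simp only [this, Finset.sum_ite_eq]
      simp [Nat.one_le_iff_ne_zero.2 h.ne']
  rw [detOn, hM, Matrix.det_mul, hU, mul_one, detOn]

theorem detOn_mul_row (J : Finset ℕ) (w : ℕ → K) (f : ℕ → ℕ → K) :
    detOn J (fun i j => w i * f i j) = (∏ i ∈ J, w i) * detOn J f := by
  rw [detOn, detOn, ← Finset.prod_coe_sort J w, ← Matrix.det_mul_column]
  rfl

/-- The Leibniz formula. The permutation is extended to all integers by the irrelevant value `0`,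
so that the product is indexed by the elements of `J` themselves. -/
theorem detOn_eq_sum (J : Finset ℕ) (f : ℕ → ℕ → K) :
    detOn J f = ∑ σ : Equiv.Perm J, ((Equiv.Perm.sign σ : ℤ) : K) *
      ∏ i ∈ J, f i (if h : i ∈ J then σ ⟨i, h⟩ else 0) := by
  rw [← detOn_transpose, detOn, Matrix.det_apply']
  refine Finset.sum_congr rfl fun σ _ => ?_
  rw [← Finset.prod_coe_sort J]
  simp

/-- The multilinearity of the determinant in its rows. -/
theorem sum_finsupp_detOn_row (J : Finset ℕ) (t : ℕ → Finset ℕ) (w : ℕ → K) (F : ℕ → ℕ → K) :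
    ∑ x ∈ J.finsupp t, (∏ j ∈ J, w (x j)) * detOn J (fun i j => F (x i) j) =
      detOn J (fun i j => ∑ b ∈ t i, w b * F b j) := by
  simp only [detOn_eq_sum, Finset.mul_sum]
  rw [Finset.sum_comm]
  refine Finset.sum_congr rfl fun σ _ => ?_
  rw [← sum_finsupp_prod J t (fun i b => w b * F b (if h : i ∈ J then σ ⟨i, h⟩ else 0)),
    Finset.mul_sum]
  refine Finset.sum_congr rfl fun x _ => ?_
  rw [Finset.prod_mul_distrib]
  ring

theorem sum_finsupp_detOn_col (J : Finset ℕ) (t : ℕ → Finset ℕ) (w : ℕ → K) (F : ℕ → ℕ → K) :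
    ∑ x ∈ J.finsupp t, (∏ j ∈ J, w (x j)) * detOn J (fun i j => F i (x j)) =
      detOn J (fun i j => ∑ b ∈ t j, w b * F i b) := by
  rw [← detOn_transpose J (fun i j => ∑ b ∈ t j, w b * F i b),
    ← sum_finsupp_detOn_row J t w (fun b i => F i b)]
  refine Finset.sum_congr rfl fun x _ => ?_
  rw [detOn_transpose J (fun i j => F i (x j))]

/-- A determinant on `I` reduces to `J ⊆ I` if the columns outside `J` are those of the identity. -/
theorem detOn_eq_of_col_eq {I J : Finset ℕ} (hJ : J ⊆ I) {f : ℕ → ℕ → K}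
    (h0 : ∀ i ∈ J, ∀ j ∈ I, j ∉ J → f i j = 0)
    (h1 : ∀ i ∈ I, i ∉ J → ∀ j ∈ I, j ∉ J → f i j = if i = j then 1 else 0) :
    detOn I f = detOn J f := by
  rw [detOn, Matrix.twoBlockTriangular_det' _ (fun i : I => (i : ℕ) ∈ J)]
  · have : Matrix.toSquareBlockProp (Matrix.of fun i j : I => f i j) (fun i => ¬ (i : ℕ) ∈ J) =
        1 := by
      ext i j
      simp only [Matrix.toSquareBlockProp_def, Matrix.of_apply, Matrix.one_apply]
      rw [h1 _ i.1.2 i.2 _ j.1.2 j.2]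
      exact if_congr (by rw [Subtype.ext_iff, Subtype.ext_iff]) rfl rfl
    rw [this, Matrix.det_one, mul_one, detOn]
    let e : J ≃ {i : I // (i : ℕ) ∈ J} :=
      { toFun := fun i => ⟨⟨i, hJ i.2⟩, i.2⟩
        invFun := fun i => ⟨i.1, i.2⟩
        left_inv := fun _ => rfl
        right_inv := fun _ => rfl }
    rw [← Matrix.det_submatrix_equiv_self e]
    rfl
  · intro i hi j hj
    exact h0 i hi j j.2 hj

/-- A determinant on `I` reduces to `J ⊆ I` if the rows outside `J` are those of the identity. -/
theorem detOn_eq_of_row_eq {I J : Finset ℕ} (hJ : J ⊆ I) {f : ℕ → ℕ → K}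
    (h0 : ∀ i ∈ I, i ∉ J → ∀ j ∈ J, f i j = 0)
    (h1 : ∀ i ∈ I, i ∉ J → ∀ j ∈ I, j ∉ J → f i j = if i = j then 1 else 0) :
    detOn I f = detOn J f := by
  rw [← detOn_transpose I, ← detOn_transpose J]
  refine detOn_eq_of_col_eq hJ (fun i hi j hj hj' => h0 j hj hj' i hi) fun i hi hi' j hj hj' => ?_
  rw [h1 j hj hj' i hi hi']
  exact if_congr eq_comm rfl rfl

end Determinants

/-! ### The connector -/

section Connector

variable {K : Type*} [Field K] (q : K) (N : ℕ)

theorem qInt_zero : qInt q 0 = 0 := by simp [qInt]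

theorem qInt_sub_qInt {a m : ℕ} (h : m ≤ a) :
    qInt q a - qInt q (a - m) = q ^ (a - m) * qInt q m := by
  obtain ⟨b, rfl⟩ := Nat.exists_eq_add_of_le' h
  rw [Nat.add_sub_cancel, qInt, qInt, qInt, Finset.sum_range_add, Finset.mul_sum,
    add_sub_cancel_left]
  simp only [pow_add]

/-- The connector `C(m, n)`, the quotient of the `q`-binomial coefficients `[n choose m]` and
`[N - 1 choose m]`. The truncated subtraction makes it vanish for `n < m`. -/
def connector (m n : ℕ) : K := ∏ i ∈ Finset.range m, qInt q (n - i) / qInt q (N - 1 - i)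

theorem connector_zero_left (n : ℕ) : connector q N 0 n = 1 := by simp [connector]

theorem connector_of_lt {m n : ℕ} (h : n < m) : connector q N m n = 0 :=
  Finset.prod_eq_zero (Finset.mem_range.2 h) (by simp [qInt_zero])

theorem connector_succ_right (m n : ℕ) : connector q N (m + 1) n =
    connector q N m n * (qInt q (n - m) / qInt q (N - 1 - m)) :=
  Finset.prod_range_succ _ _

theorem connector_succ_succ (m n : ℕ) : connector q N (m + 1) (n + 1) =
    connector q N m n * (qInt q (n + 1) / qInt q (N - 1 - m)) := by
  rw [connector, connector, Finset.prod_div_distrib, Finset.prod_div_distrib,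
    Finset.prod_range_succ', Finset.prod_range_succ]
  simp only [Nat.add_sub_add_right, Nat.sub_zero]
  rw [mul_div_mul_comm]

variable {q N} (hq : ∀ n : ℕ, 0 < n → n < N → qInt q n ≠ 0)
include hq

theorem connector_top {m : ℕ} (h : m ≤ N - 1) : connector q N m (N - 1) = 1 :=
  Finset.prod_eq_one fun i hi => div_self (hq _ (by rw [Finset.mem_range] at hi; omega)
    (by rw [Finset.mem_range] at hi; omega))

theorem weight_mul_connector_sub {m a : ℕ} (hm : 1 ≤ m) (hmN : m < N) (haN : a + 1 < N) :
    q ^ m / qInt q m * (connector q N m (a + 1) - connector q N m a) =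
      q ^ (a + 1) / qInt q (a + 1) * connector q N m (a + 1) := by
  obtain ⟨m, rfl⟩ := Nat.exists_eq_add_of_le' hm
  rw [connector_succ_succ, connector_succ_right]
  rcases lt_or_ge a m with h | h
  · rw [connector_of_lt q N h]; ring
  have h1 := hq (m + 1) (by omega) hmN
  have h2 := hq (a + 1) (by omega) haN
  have h3 := hq (N - 1 - m) (by omega) (by omega)
  have h4 := qInt_sub_qInt q (show m + 1 ≤ a + 1 by omega)
  rw [Nat.add_sub_add_right] at h4
  have h5 : q ^ (a + 1) = q ^ (m + 1) * q ^ (a - m) := by rw [← pow_add]; congr 1; omega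
  rw [← mul_sub, ← sub_div, h4, h5]
  field_simp

theorem inv_mul_connector_sub {m n : ℕ} (hmN : m + 1 < N) (hnN : n + 1 < N) :
    1 / qInt q (m + 1) * (connector q N (m + 1) (n + 1) - connector q N (m + 1) n) =
      1 / qInt q (N - (n + 1)) * (connector q N m n - connector q N (m + 1) n) := by
  rw [connector_succ_succ, connector_succ_right]
  rcases lt_or_ge n m with h | h
  · rw [connector_of_lt q N h]; ring
  have h1 := hq (m + 1) (by omega) hmN
  have h2 := hq (N - (n + 1)) (by omega) (by omega)
  have h3 := hq (N - 1 - m) (by omega) (by omega)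
  have h4 := qInt_sub_qInt q (show m + 1 ≤ n + 1 by omega)
  rw [Nat.add_sub_add_right] at h4
  have h5 := qInt_sub_qInt q (show N - (n + 1) ≤ N - 1 - m by omega)
  rw [show N - 1 - m - (N - (n + 1)) = n - m by omega] at h5
  rw [← mul_sub, ← sub_div, h4]
  have h6 : connector q N m n - connector q N m n * (qInt q (n - m) / qInt q (N - 1 - m)) =
      connector q N m n * ((qInt q (N - 1 - m) - qInt q (n - m)) / qInt q (N - 1 - m)) := by
    field_simp
  rw [h6, h5]
  field_simp

theorem sum_weight_connector {m : ℕ} (hm : 1 ≤ m) (hmN : m < N) {l h : ℕ} (hlh : l ≤ h)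
    (hh : h ≤ N - 1) : ∑ z ∈ Finset.Ioc l h, q ^ z / qInt q z * connector q N m z =
      q ^ m / qInt q m * (connector q N m h - connector q N m l) := by
  induction h, hlh using Nat.le_induction with
  | base => simp
  | succ h hlh ih =>
    rw [← Finset.sum_Ioc_consecutive _ hlh (Nat.le_succ h), ih (by omega), Nat.Ioc_succ_singleton,
      Finset.sum_singleton, ← weight_mul_connector_sub hq hm hmN (by omega)]
    ring

/-- The case of an interval `(n, n + 1]` of `sum_inv_connector`: the sum over `x` telescopes. -/
theorem sum_inv_connector_aux {l u n : ℕ} (hlu : l ≤ u) (hu : u ≤ N - 1) (hn : n + 1 < N) :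
    ∑ x ∈ Finset.Ioc l u, 1 / qInt q x * (connector q N x (n + 1) - connector q N x n) =
      1 / qInt q (N - (n + 1)) * (connector q N l n - connector q N u n) := by
  induction u, hlu using Nat.le_induction with
  | base => simp
  | succ u hlu ih =>
    rw [← Finset.sum_Ioc_consecutive _ hlu (Nat.le_succ u), ih (by omega), Nat.Ioc_succ_singleton,
      Finset.sum_singleton, inv_mul_connector_sub hq (by omega) hn]
    ring

theorem sum_inv_connector {l u a b : ℕ} (hlu : l ≤ u) (hu : u ≤ N - 1) (hab : a ≤ b)
    (hb : b ≤ N - 1) :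
    ∑ x ∈ Finset.Ioc l u, 1 / qInt q x * (connector q N x b - connector q N x a) =
      ∑ z ∈ Finset.Ioc a b, 1 / qInt q (N - z) *
        (connector q N l (z - 1) - connector q N u (z - 1)) := by
  induction b, hab using Nat.le_induction with
  | base => simp
  | succ b hab ih =>
    rw [← Finset.sum_Ioc_consecutive _ hab (Nat.le_succ b), ← ih (by omega), Nat.Ioc_succ_singleton,
      Finset.sum_singleton, Nat.add_sub_cancel, ← sum_inv_connector_aux hq hlu hu (by omega),
      ← Finset.sum_add_distrib]
    refine Finset.sum_congr rfl fun x _ => ?_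
    ring

end Connector

/-! ### The transfer kernel between neighbouring diagonals -/

section Transfer

open scoped Classical

/-- `x` weakly increases along consecutive indices in `J`. -/
def StepMono (J : Finset ℕ) (x : ℕ → ℕ) : Prop := ∀ j, j ∈ J → j + 1 ∈ J → x j ≤ x (j + 1)

/-- `J` and `J'` are intervals such that the tuples on them can interlace: each endpoint of `J'`
either agrees with the one of `J` or precedes it by `1`. -/
def Interlaced (J J' : Finset ℕ) : Prop :=
  ∃ s t s' t', J = Finset.Ico s t ∧ J' = Finset.Ico s' t' ∧ s' ≤ s ∧ s ≤ s' + 1 ∧ t' ≤ t ∧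
    t ≤ t' + 1 ∧ s ≤ t ∧ s' ≤ t'

theorem StrictRel.stepMono_right {J J' : Finset ℕ} (h : Interlaced J J') {m n : ℕ → ℕ}
    (hmn : StrictRel J J' m n) : StepMono J' n := by
  obtain ⟨s, t, s', t', rfl, rfl, _⟩ := h
  intro j hj hj'
  simp only [StrictRel, Finset.mem_Ico] at *
  have h1 := hmn.1 (j + 1) (by omega) hj'
  have h2 := hmn.2 j (by omega) hj
  omega

theorem StrictRel.stepMono_left {J J' : Finset ℕ} (h : Interlaced J J') {m n : ℕ → ℕ}
    (hmn : StrictRel J J' m n) : StepMono J m := by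
  obtain ⟨s, t, s', t', rfl, rfl, _⟩ := h
  intro j hj hj'
  simp only [StrictRel, Finset.mem_Ico] at *
  have h1 := hmn.1 j hj (by omega)
  have h2 := hmn.2 j hj' (by omega)
  omega

theorem WeakRel.stepMono_left {J : Finset ℕ} {m n : ℕ → ℕ} (h : WeakRel J J m n) :
    StepMono J m := fun j hj hj' => (h.1 j hj hj).trans (h.2 j hj' hj).le

/-- The lower thresholds `n_{j-1} - 1` on `m` in the relation `m ◁ n`, for `n` on `J'`. -/
def strictLo (J' : Finset ℕ) (n : ℕ → ℕ) (j : ℕ) : ℕ :=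
  if 1 ≤ j ∧ j - 1 ∈ J' then n (j - 1) - 1 else 0

/-- The upper thresholds `n_j - 1` on `m` in the relation `m ◁ n`, for `n` on `J'`. -/
def strictHi (N : ℕ) (J' : Finset ℕ) (n : ℕ → ℕ) (j : ℕ) : ℕ :=
  if j ∈ J' then n j - 1 else N - 1

/-- The lower thresholds `n_{j-1}` on `m` in the relation `m ⊴ n`, for `n` on `J`. -/
def weakLo (J : Finset ℕ) (n : ℕ → ℕ) (j : ℕ) : ℕ := if 1 ≤ j ∧ j - 1 ∈ J then n (j - 1) else 0

/-- The lower thresholds `m_j` on `n` in the relation `m ◁ n`, for `m` on `J`. -/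
def nextLo (J : Finset ℕ) (m : ℕ → ℕ) (j : ℕ) : ℕ := if j ∈ J then m j else 0

/-- The upper thresholds `m_{j+1}` on `n` in the relation `m ◁ n`, for `m` on `J`. -/
def nextHi (N : ℕ) (J : Finset ℕ) (m : ℕ → ℕ) (j : ℕ) : ℕ :=
  if j + 1 ∈ J then m (j + 1) else N - 1

section Thresholds

variable {N : ℕ} {J J' : Finset ℕ} {m n : ℕ → ℕ}

theorem strictHi_le (hn : ∀ j ∈ J', n j ∈ Finset.Icc 1 (N - 1)) (j : ℕ) :
    strictHi N J' n j ≤ N - 1 := by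
  unfold strictHi
  split_ifs with h
  · have := Finset.mem_Icc.1 (hn j h); omega
  · exact le_rfl

theorem nextHi_le (hm : ∀ j ∈ J, m j ∈ Finset.Icc 1 (N - 1)) (j : ℕ) :
    nextHi N J m j ≤ N - 1 := by
  unfold nextHi
  split_ifs with h
  · exact (Finset.mem_Icc.1 (hm _ h)).2
  · exact le_rfl

theorem strictLo_le_strictHi (hn : ∀ j ∈ J', n j ∈ Finset.Icc 1 (N - 1)) (h : StepMono J' n)
    (j : ℕ) : strictLo J' n j ≤ strictHi N J' n j := by
  unfold strictLo strictHi
  split_ifs with h1 h2 h2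
  · have := h (j - 1) h1.2 (by rwa [Nat.sub_add_cancel h1.1])
    rw [Nat.sub_add_cancel h1.1] at this
    omega
  · have := Finset.mem_Icc.1 (hn _ h1.2); omega
  · omega
  · omega

theorem weakLo_le (h : StepMono J n) {j : ℕ} (hj : j ∈ J) : weakLo J n j ≤ n j := by
  unfold weakLo
  split_ifs with h1
  · have := h (j - 1) h1.2 (by rwa [Nat.sub_add_cancel h1.1])
    rwa [Nat.sub_add_cancel h1.1] at this
  · omega

theorem nextLo_le_nextHi (hm : ∀ j ∈ J, m j ∈ Finset.Icc 1 (N - 1)) (h : StepMono J m)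
    (j : ℕ) : nextLo J m j ≤ nextHi N J m j := by
  unfold nextLo nextHi
  split_ifs with h1 h2 h2
  · exact h j h1 h2
  · exact (Finset.mem_Icc.1 (hm _ h1)).2
  · omega
  · omega

theorem strictRel_iff_next (hn : ∀ j ∈ J', n j ∈ Finset.Icc 1 (N - 1)) :
    StrictRel J J' m n ↔ ∀ j ∈ J', n j ∈ Finset.Ioc (nextLo J m j) (nextHi N J m j) := by
  simp only [Finset.mem_Icc, Finset.mem_Ioc, nextLo, nextHi] at *
  constructor
  · intro h j hj
    have := hn j hj
    have h1 := h.1 j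
    have h2 := h.2 j
    constructor <;> split_ifs with h3
    · exact h1 h3 hj
    · omega
    · exact h2 h3 hj
    · omega
  · intro h
    refine ⟨fun j hj hj' => ?_, fun j hj hj' => ?_⟩
    · simpa [hj] using (h j hj').1
    · simpa [hj] using (h j hj').2

theorem strictRel_iff_strict (hm : ∀ j ∈ J, m j ∈ Finset.Icc 1 (N - 1))
    (hn : ∀ j ∈ J', n j ∈ Finset.Icc 1 (N - 1)) :
    StrictRel J J' m n ↔ ∀ j ∈ J, m j ∈ Finset.Ioc (strictLo J' n j) (strictHi N J' n j) := by
  simp only [Finset.mem_Icc, Finset.mem_Ioc, strictLo, strictHi] at *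
  constructor
  · intro h j hj
    have := hm j hj
    have h1 := h.1 j hj
    constructor <;> split_ifs with h3
    · have h2 := h.2 (j - 1) (by rwa [Nat.sub_add_cancel h3.1]) h3.2
      rw [Nat.sub_add_cancel h3.1] at h2
      have := hn _ h3.2
      omega
    · omega
    · have := h1 h3
      omega
    · omega
  · intro h
    refine ⟨fun j hj hj' => ?_, fun j hj hj' => ?_⟩
    · have h1 := (h j hj).2
      have := hn j hj'
      rw [if_pos hj'] at h1
      omega
    · have h1 := (h (j + 1) hj).1
      rw [Nat.add_sub_cancel, if_pos ⟨by omega, hj'⟩] at h1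
      omega

theorem weakRel_iff (hm : ∀ j ∈ J, m j ∈ Finset.Icc 1 (N - 1)) :
    WeakRel J J m n ↔ ∀ j ∈ J, m j ∈ Finset.Ioc (weakLo J n j) (n j) := by
  simp only [Finset.mem_Icc, Finset.mem_Ioc, weakLo] at *
  constructor
  · intro h j hj
    have := hm j hj
    have h1 := h.1 j hj hj
    refine ⟨?_, h1⟩
    split_ifs with h3
    · have h2 := h.2 (j - 1) (by rwa [Nat.sub_add_cancel h3.1]) h3.2
      rwa [Nat.sub_add_cancel h3.1] at h2
    · omega
  · intro h
    refine ⟨fun j hj hj' => (h j hj).2, fun j hj hj' => ?_⟩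
    have h1 := (h (j + 1) hj).1
    rwa [Nat.add_sub_cancel, if_pos ⟨by omega, hj'⟩] at h1

/-- A relation that confines each entry to an interval turns a sum over all tuples into a sum over
a product of intervals. -/
theorem sum_finsupp_ite {K : Type*} [CommRing K] {P : (ℕ → ℕ) → Prop} {lo hi : ℕ → ℕ}
    (hhi : ∀ j ∈ J, hi j ≤ N - 1)
    (hP : ∀ x : ℕ → ℕ, (∀ j ∈ J, x j ∈ Finset.Icc 1 (N - 1)) →
      (P x ↔ ∀ j ∈ J, x j ∈ Finset.Ioc (lo j) (hi j))) (F : (ℕ → ℕ) → K) :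
    ∑ x ∈ J.finsupp (fun _ => Finset.Icc 1 (N - 1)), (if P x then F x else 0) =
      ∑ x ∈ J.finsupp (fun j => Finset.Ioc (lo j) (hi j)), F x := by
  rw [← Finset.sum_filter]
  refine Finset.sum_congr ?_ fun _ _ => rfl
  ext x
  simp only [Finset.mem_filter, Finset.mem_finsupp_iff]
  constructor
  · rintro ⟨⟨h1, h2⟩, h3⟩
    exact ⟨h1, (hP x h2).1 h3⟩
  · rintro ⟨h1, h2⟩
    have h3 : ∀ j ∈ J, x j ∈ Finset.Icc 1 (N - 1) := fun j hj => by
      have := Finset.mem_Ioc.1 (h2 j hj)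
      have := hhi j hj
      rw [Finset.mem_Icc]
      omega
    exact ⟨⟨h1, h3⟩, (hP x h3).2 h2⟩

end Thresholds

variable {K : Type*} [Field K] (q : K) (N : ℕ)

/-- The determinant of the differences `C(m_i, hi_j) - C(m_i, lo_j)` of connectors. -/
def detDiff (J : Finset ℕ) (m lo hi : ℕ → ℕ) : K :=
  detOn J fun i j => connector q N (m i) (hi j) - connector q N (m i) (lo j)

/-- The kernel which connects a tuple `m` on the diagonal with columns `J` to a tuple `n` on the
next diagonal, with columns `J'`. -/
def transfer (J J' : Finset ℕ) (m n : ℕ → ℕ) : K :=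
  detDiff q N J m (strictLo J' n) (strictHi N J' n)

variable {q N}

theorem detOn_connector {J : Finset ℕ} {m : ℕ → ℕ} (hm : ∀ j ∈ J, m j ∈ Finset.Icc 1 (N - 1))
    (y : ℕ → ℕ) : detOn J (fun i j => connector q N (m i) (y j)) =
      detDiff q N J m (weakLo J y) y := by
  rw [detDiff, ← detOn_col_sub_pred]
  refine detOn_congr fun i hi j hj => ?_
  rw [weakLo]
  split_ifs with h
  · rfl
  · rw [connector_of_lt q N (Finset.mem_Icc.1 (hm i hi)).1]

variable (hq : ∀ n : ℕ, 0 < n → n < N → qInt q n ≠ 0)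
include hq

/-- The kernel, defined by differences of columns indexed by `J`, is also a determinant of
differences of rows indexed by `J'`. -/
theorem transfer_eq {J J' : Finset ℕ} (hJ : Interlaced J J') {m n : ℕ → ℕ}
    (hm : ∀ j ∈ J, m j ∈ Finset.Icc 1 (N - 1)) (hn : ∀ j ∈ J', n j ∈ Finset.Icc 1 (N - 1)) :
    transfer q N J J' m n = detOn J' (fun i j => connector q N (nextLo J m i) (n j - 1) -
      connector q N (nextHi N J m i) (n j - 1)) := by
  obtain ⟨s, t, s', t', rfl, rfl, _, _, _, _, _, _⟩ := hJ
  simp only [Finset.mem_Ico, Finset.mem_Icc] at hm hn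
  have hlo : ∀ i, nextLo (Finset.Ico s t) m i ≤ N - 1 := by
    intro i
    rw [nextLo]
    split_ifs with h
    · rw [Finset.mem_Ico] at h; exact (hm i h).2
    · omega
  -- Both sides equal a determinant on `Ico s' t`, which contains both index sets. The row of a
  -- missing `m_i` and the column of a missing `n_j` in it consist of ones.
  trans detOn (Finset.Ico s' t) (fun i j => (connector q N (nextLo (Finset.Ico s t) m i)
    (strictHi N (Finset.Ico s' t') n j) : K))
  · rw [transfer, detDiff, ← detOn_col_sub_pred (Finset.Ico s' t),
      detOn_eq_of_row_eq (I := Finset.Ico s' t) (J := Finset.Ico s t)]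
    · refine detOn_congr fun i hi j hj => ?_
      have hi' := hi
      rw [Finset.mem_Ico] at hi hj
      simp only [nextLo, strictLo, strictHi, hi', Finset.mem_Ico, if_true]
      by_cases h : 1 ≤ j ∧ s' ≤ j - 1
      · rw [if_pos (show 1 ≤ j ∧ s' ≤ j - 1 ∧ j - 1 < t' by omega),
          if_pos (show 1 ≤ j ∧ s' ≤ j - 1 ∧ j - 1 < t by omega),
          if_pos (show s' ≤ j - 1 ∧ j - 1 < t' by omega)]
      · rw [if_neg (show ¬ (1 ≤ j ∧ s' ≤ j - 1 ∧ j - 1 < t') by omega),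
          if_neg (show ¬ (1 ≤ j ∧ s' ≤ j - 1 ∧ j - 1 < t) by omega),
          connector_of_lt q N (m := m i) (hm i hi).1]
    · exact Finset.Ico_subset_Ico_left ‹_›
    · intro i hi hi' j hj
      rw [Finset.mem_Ico] at hi hj
      rw [nextLo, if_neg hi', connector_zero_left, connector_zero_left, if_pos, sub_self]
      rw [Finset.mem_Ico] at hi' ⊢
      omega
    · intro i hi hi' j hj hj'
      rw [nextLo, if_neg hi', connector_zero_left, connector_zero_left]
      simp only [Finset.mem_Ico] at hi hi' hj hj' ⊢
      rw [if_neg (by omega), if_pos (by omega), sub_zero]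
  · rw [← detOn_row_sub_succ, detOn_eq_of_col_eq (J := Finset.Ico s' t')]
    · refine detOn_congr fun i hi j hj => ?_
      have hj' := hj
      rw [Finset.mem_Ico] at hi hj
      simp only [nextLo, nextHi, strictHi, hj', Finset.mem_Ico, if_true]
      congr 1
      by_cases h : i + 1 < t
      · rw [if_pos (by omega), if_pos (by omega), if_pos (by omega)]
      · rw [if_neg (by omega), if_neg (by omega), connector_of_lt]
        have := hn j hj
        omega
    · exact Finset.Ico_subset_Ico_right ‹_›
    · intro i hi j hj hj'
      rw [Finset.mem_Ico] at hi hj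
      rw [strictHi, if_neg hj', connector_top hq (hlo _), connector_top hq (hlo _), if_pos,
        sub_self]
      rw [Finset.mem_Ico] at hj' ⊢
      omega
    · intro i hi hi' j hj hj'
      rw [strictHi, if_neg hj', connector_top hq (hlo _), connector_top hq (hlo _)]
      simp only [Finset.mem_Ico] at hi hi' hj hj' ⊢
      rw [if_neg (by omega), if_pos (by omega), sub_zero]

theorem sum_weight_detOn {J : Finset ℕ} {m lo hi : ℕ → ℕ}
    (hm : ∀ j ∈ J, m j ∈ Finset.Icc 1 (N - 1)) (hlo : ∀ j ∈ J, lo j ≤ hi j)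
    (hhi : ∀ j ∈ J, hi j ≤ N - 1) :
    ∑ z ∈ J.finsupp (fun j => Finset.Ioc (lo j) (hi j)),
      (∏ j ∈ J, q ^ z j / qInt q (z j)) * detOn J (fun i j => connector q N (m i) (z j)) =
    (∏ j ∈ J, q ^ m j / qInt q (m j)) * detDiff q N J m lo hi := by
  rw [sum_finsupp_detOn_col J (fun j => Finset.Ioc (lo j) (hi j)) (fun z => q ^ z / qInt q z)
    (fun i z => connector q N (m i) z), detDiff, ← detOn_mul_row J fun i => q ^ m i / qInt q (m i)]
  refine detOn_congr fun i hi j hj => ?_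
  have := Finset.mem_Icc.1 (hm i hi)
  exact sum_weight_connector hq (by omega) (by omega) (hlo j hj) (hhi j hj)

/-- The tableau entries on the diagonal with columns `J'` are summed out: the rows of the
determinant are summed over the intervals between neighbouring entries of `m`, and
`sum_inv_connector` exchanges them for sums over columns. -/
theorem sum_strictRel_inv_detDiff {J J' : Finset ℕ} (hJ : Interlaced J J') {m lo hi : ℕ → ℕ}
    (hm : ∀ j ∈ J, m j ∈ Finset.Icc 1 (N - 1)) (hm' : StepMono J m)
    (hlo : ∀ j ∈ J', lo j ≤ hi j) (hhi : ∀ j ∈ J', hi j ≤ N - 1) :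
    ∑ x ∈ J'.finsupp (fun _ => Finset.Icc 1 (N - 1)), (if StrictRel J J' m x then
      (∏ j ∈ J', 1 / qInt q (x j)) * detDiff q N J' x lo hi else 0) =
    ∑ z ∈ J'.finsupp (fun j => Finset.Ioc (lo j) (hi j)),
      (∏ j ∈ J', 1 / qInt q (N - z j)) * transfer q N J J' m z := by
  rw [sum_finsupp_ite (P := fun x => StrictRel J J' m x)
    (F := fun x => (∏ j ∈ J', 1 / qInt q (x j)) * detDiff q N J' x lo hi)
    (fun j _ => nextHi_le hm j) (fun x hx => strictRel_iff_next hx)]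
  trans detOn J' (fun i j => ∑ x ∈ Finset.Ioc (nextLo J m i) (nextHi N J m i),
    1 / qInt q x * (connector q N x (hi j) - connector q N x (lo j)))
  · rw [← sum_finsupp_detOn_row J' (fun i => Finset.Ioc (nextLo J m i) (nextHi N J m i))
      (fun x => 1 / qInt q x) (fun x j => connector q N x (hi j) - connector q N x (lo j))]
    rfl
  trans detOn J' (fun i j => ∑ z ∈ Finset.Ioc (lo j) (hi j), 1 / qInt q (N - z) *
    (connector q N (nextLo J m i) (z - 1) - connector q N (nextHi N J m i) (z - 1)))
  · exact detOn_congr fun i hi j hj => sum_inv_connector hq (nextLo_le_nextHi hm hm' i)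
      (nextHi_le hm i) (hlo j hj) (hhi j hj)
  · rw [← sum_finsupp_detOn_col J' (fun j => Finset.Ioc (lo j) (hi j))
      (fun z => 1 / qInt q (N - z)) (fun i z => connector q N (nextLo J m i) (z - 1) -
        connector q N (nextHi N J m i) (z - 1))]
    refine Finset.sum_congr rfl fun z hz => ?_
    rw [Finset.mem_finsupp_iff] at hz
    rw [transfer_eq hq hJ hm fun j hj => ?_]
    have := Finset.mem_Ioc.1 (hz.2 j hj)
    have := hhi j hj
    rw [Finset.mem_Icc]
    omega

theorem sum_weakRel_weight_detOn {J : Finset ℕ} {m y : ℕ → ℕ}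
    (hm : ∀ j ∈ J, m j ∈ Finset.Icc 1 (N - 1)) (hy : ∀ j ∈ J, y j ∈ Finset.Icc 1 (N - 1))
    (hy' : StepMono J y) :
    ∑ x ∈ J.finsupp (fun _ => Finset.Icc 1 (N - 1)), (if WeakRel J J x y then
      (∏ j ∈ J, q ^ x j / qInt q (x j)) * detOn J (fun i j => connector q N (m i) (x j)) else 0) =
    (∏ j ∈ J, q ^ m j / qInt q (m j)) * detOn J (fun i j => connector q N (m i) (y j)) := by
  have hy2 : ∀ j ∈ J, y j ≤ N - 1 := fun j hj => (Finset.mem_Icc.1 (hy j hj)).2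
  rw [sum_finsupp_ite (P := fun x => WeakRel J J x y) (F := fun x => (∏ j ∈ J, q ^ x j /
    qInt q (x j)) * detOn J (fun i j => connector q N (m i) (x j))) hy2
    (fun x hx => weakRel_iff hx), detOn_connector hm]
  exact sum_weight_detOn hq hm (fun j hj => weakLo_le hy' hj) hy2

theorem sum_strictRel_weight_detOn {J J' : Finset ℕ} {m n : ℕ → ℕ}
    (hm : ∀ j ∈ J, m j ∈ Finset.Icc 1 (N - 1)) (hn : ∀ j ∈ J', n j ∈ Finset.Icc 1 (N - 1))
    (hn' : StepMono J' n) :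
    ∑ x ∈ J.finsupp (fun _ => Finset.Icc 1 (N - 1)), (if StrictRel J J' x n then
      (∏ j ∈ J, q ^ x j / qInt q (x j)) * detOn J (fun i j => connector q N (m i) (x j)) else 0) =
    (∏ j ∈ J, q ^ m j / qInt q (m j)) * transfer q N J J' m n := by
  rw [sum_finsupp_ite (P := fun x => StrictRel J J' x n) (F := fun x => (∏ j ∈ J, q ^ x j /
    qInt q (x j)) * detOn J (fun i j => connector q N (m i) (x j))) (fun j _ => strictHi_le hn j)
    (fun x hx => strictRel_iff_strict hx hn)]
  exact sum_weight_detOn hq hm (fun j _ => strictLo_le_strictHi hn hn' j)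
    (fun j _ => strictHi_le hn j)

theorem sum_weakRel_inv_transfer {J J' : Finset ℕ} (hJ : Interlaced J J') {m y : ℕ → ℕ}
    (hm : ∀ j ∈ J, m j ∈ Finset.Icc 1 (N - 1)) (hm' : StepMono J m)
    (hy : ∀ j ∈ J', y j ∈ Finset.Icc 1 (N - 1)) (hy' : StepMono J' y) :
    ∑ z ∈ J'.finsupp (fun _ => Finset.Icc 1 (N - 1)), (if WeakRel J' J' z y then
      (∏ j ∈ J', 1 / qInt q (N - z j)) * transfer q N J J' m z else 0) =
    ∑ x ∈ J'.finsupp (fun _ => Finset.Icc 1 (N - 1)), (if StrictRel J J' m x then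
      (∏ j ∈ J', 1 / qInt q (x j)) * detOn J' (fun i j => connector q N (x i) (y j)) else 0) := by
  have hy2 : ∀ j ∈ J', y j ≤ N - 1 := fun j hj => (Finset.mem_Icc.1 (hy j hj)).2
  rw [sum_finsupp_ite (P := fun x => WeakRel J' J' x y) (F := fun z => (∏ j ∈ J', 1 /
    qInt q (N - z j)) * transfer q N J J' m z) hy2 (fun x hx => weakRel_iff hx),
    ← sum_strictRel_inv_detDiff hq hJ hm hm' (fun j hj => weakLo_le hy' hj) hy2]
  refine Finset.sum_congr rfl fun x hx => ?_
  rw [Finset.mem_finsupp_iff] at hx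
  rw [detOn_connector hx.2]

theorem sum_strictRel_inv_transfer {J J' J'' : Finset ℕ} (hJ : Interlaced J J') {m n : ℕ → ℕ}
    (hm : ∀ j ∈ J, m j ∈ Finset.Icc 1 (N - 1)) (hm' : StepMono J m)
    (hn : ∀ j ∈ J'', n j ∈ Finset.Icc 1 (N - 1)) (hn' : StepMono J'' n) :
    ∑ z ∈ J'.finsupp (fun _ => Finset.Icc 1 (N - 1)), (if StrictRel J' J'' z n then
      (∏ j ∈ J', 1 / qInt q (N - z j)) * transfer q N J J' m z else 0) =
    ∑ x ∈ J'.finsupp (fun _ => Finset.Icc 1 (N - 1)), (if StrictRel J J' m x then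
      (∏ j ∈ J', 1 / qInt q (x j)) * transfer q N J' J'' x n else 0) := by
  rw [sum_finsupp_ite (P := fun x => StrictRel J' J'' x n) (F := fun z => (∏ j ∈ J', 1 /
    qInt q (N - z j)) * transfer q N J J' m z) (fun j _ => strictHi_le hn j)
    (fun x hx => strictRel_iff_strict hx hn),
    ← sum_strictRel_inv_detDiff hq hJ hm hm' (fun j _ => strictLo_le_strictHi hn hn' j)
    (fun j _ => strictHi_le hn j)]
  rfl

omit hq in
variable (q N) in
/-- The kernel of the chain of the tuples `n^(1), …, n^(k)` on a diagonal with columns `J`,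
where `n` is the first tuple on the next diagonal, with columns `J'`. -/
noncomputable def blockKernel (J J' : Finset ℕ) (k : ℕ) (n : ℕ → ℕ) (l : ℕ) (x y : ℕ → ℕ) : K :=
  if (if l < k then WeakRel J J x y else StrictRel J J' x n) then
    ∏ j ∈ J, (if l = 1 then 1 / qInt q (N - x j) else q ^ x j / qInt q (x j)) else 0

omit hq in
/-- A tuple that does not increase weakly is in no relation to a next tuple. This disposes of the
tuples for which the thresholds do not form intervals. -/
theorem blockKernel_eq_zero {J J' : Finset ℕ} (hJ : Interlaced J J') {k l : ℕ} {n x : ℕ → ℕ}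
    (hx : ¬ StepMono J x) (y : ℕ → ℕ) : blockKernel q N J J' k n l x y = 0 := by
  rw [blockKernel, if_neg]
  split_ifs
  · exact fun h => hx h.stepMono_left
  · exact fun h => hx (h.stepMono_left hJ)

/-- Each tuple of the chain after the first one absorbs a factor `q^m / [m]` of each entry of
`m`. -/
theorem sum_detOn_mul_chainSum {J J' : Finset ℕ} (hJ : Interlaced J J') {m n : ℕ → ℕ}
    (hm : ∀ j ∈ J, m j ∈ Finset.Icc 1 (N - 1)) (hn : ∀ j ∈ J', n j ∈ Finset.Icc 1 (N - 1))
    (hn' : StepMono J' n) {k l L : ℕ} (hl : 2 ≤ l) (hk : l + L = k) :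
    ∑ x ∈ J.finsupp (fun _ => Finset.Icc 1 (N - 1)), detOn J (fun i j => connector q N (m i) (x j)) *
      chainSum (Finset.Icc 1 (N - 1)) (fun _ => J) (blockKernel q N J J' k n) id L l x =
    (∏ j ∈ J, q ^ m j / qInt q (m j)) ^ (L + 1) * transfer q N J J' m n := by
  induction L generalizing l with
  | zero =>
    rw [zero_add, pow_one, ← sum_strictRel_weight_detOn hq hm hn hn']
    refine Finset.sum_congr rfl fun x _ => ?_
    simp only [chainSum, blockKernel, id, show ¬ l < k by omega, if_false, show l ≠ 1 by omega]
    rw [mul_ite, mul_zero, mul_comm]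
  | succ L ih =>
    have h1 : ∀ y ∈ J.finsupp (fun _ => Finset.Icc 1 (N - 1)), ∑ x ∈ J.finsupp
        (fun _ => Finset.Icc 1 (N - 1)), detOn J (fun i j => connector q N (m i) (x j)) *
          (blockKernel q N J J' k n l x y * chainSum (Finset.Icc 1 (N - 1)) (fun _ => J)
            (blockKernel q N J J' k n) id L (l + 1) y) =
        (∏ j ∈ J, q ^ m j / qInt q (m j)) * (detOn J (fun i j => connector q N (m i) (y j)) *
          chainSum (Finset.Icc 1 (N - 1)) (fun _ => J) (blockKernel q N J J' k n) id L (l + 1) y) := by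
      intro y hy
      by_cases hy' : StepMono J y
      · rw [← mul_assoc, ← sum_weakRel_weight_detOn hq hm (Finset.mem_finsupp_iff.1 hy).2 hy',
          Finset.sum_mul]
        refine Finset.sum_congr rfl fun x _ => ?_
        simp only [blockKernel, show l < k by omega, if_true, show l ≠ 1 by omega, if_false]
        split_ifs <;> ring
      · rw [chainSum_eq_zero (fun z => blockKernel_eq_zero hJ hy' z)]
        simp
    simp only [chainSum, Finset.mul_sum, id]
    rw [Finset.sum_comm, Finset.sum_congr rfl h1, ← Finset.mul_sum, ih (by omega) (by omega)]
    ring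

/-- The transport across one diagonal: summing out the tableau entries on a diagonal turns the
kernel from that diagonal to the next one into the kernel from the previous diagonal to the
chain of tuples of the `q♭`-sum. -/
theorem sum_transfer_mul_chainSum {J J' J'' : Finset ℕ} (hJ : Interlaced J J')
    (hJ' : Interlaced J' J'') {m n : ℕ → ℕ}
    (hm : ∀ j ∈ J, m j ∈ Finset.Icc 1 (N - 1)) (hm' : StepMono J m)
    (hn : ∀ j ∈ J'', n j ∈ Finset.Icc 1 (N - 1)) (hn' : StepMono J'' n) (L : ℕ) :
    ∑ x ∈ J'.finsupp (fun _ => Finset.Icc 1 (N - 1)), transfer q N J J' m x *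
      chainSum (Finset.Icc 1 (N - 1)) (fun _ => J') (blockKernel q N J' J'' (L + 1) n) id L 1 x =
    ∑ x ∈ J'.finsupp (fun _ => Finset.Icc 1 (N - 1)), (if StrictRel J J' m x then
      (∏ j ∈ J', q ^ (L * x j) / qInt q (x j) ^ (L + 1)) * transfer q N J' J'' x n else 0) := by
  have hw : ∀ (L : ℕ) (x : ℕ → ℕ), ∏ j ∈ J', q ^ (L * x j) / qInt q (x j) ^ (L + 1) =
      (∏ j ∈ J', 1 / qInt q (x j)) * (∏ j ∈ J', q ^ x j / qInt q (x j)) ^ L := by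
    intro L x
    rw [← Finset.prod_pow, ← Finset.prod_mul_distrib]
    refine Finset.prod_congr rfl fun j _ => ?_
    rw [div_pow, div_mul_div_comm, one_mul, ← pow_mul, pow_succ', mul_comm (x j)]
  cases L with
  | zero =>
    rw [Finset.sum_congr rfl fun x hx => ?_, sum_strictRel_inv_transfer hq hJ hm hm' hn hn']
    · refine Finset.sum_congr rfl fun x _ => ?_
      simp
    · simp only [chainSum, blockKernel, id]
      simp only [zero_add, lt_irrefl, if_false, if_true]
      rw [mul_ite, mul_zero, mul_comm]
  | succ L =>
    have h1 : ∀ y ∈ J'.finsupp (fun _ => Finset.Icc 1 (N - 1)), ∑ x ∈ J'.finsupp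
        (fun _ => Finset.Icc 1 (N - 1)), transfer q N J J' m x *
          (blockKernel q N J' J'' (L + 1 + 1) n 1 x y * chainSum (Finset.Icc 1 (N - 1)) (fun _ => J')
            (blockKernel q N J' J'' (L + 1 + 1) n) id L (1 + 1) y) =
        ∑ x ∈ J'.finsupp (fun _ => Finset.Icc 1 (N - 1)), (if StrictRel J J' m x then
          (∏ j ∈ J', 1 / qInt q (x j)) else 0) *
            (detOn J' (fun i j => connector q N (x i) (y j)) *
          chainSum (Finset.Icc 1 (N - 1)) (fun _ => J') (blockKernel q N J' J'' (L + 1 + 1) n) id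
            L (1 + 1) y) := by
      intro y hy
      by_cases hy' : StepMono J' y
      · have := sum_weakRel_inv_transfer hq hJ hm hm' (Finset.mem_finsupp_iff.1 hy).2 hy'
        simp only [← mul_assoc, ← Finset.sum_mul]
        congr 1
        convert this using 2 with x _ x _
        · simp only [blockKernel, show 1 < L + 1 + 1 by omega, if_true]
          rw [mul_ite, mul_zero, mul_comm]
        · rw [ite_mul, zero_mul]
      · rw [chainSum_eq_zero (fun z => blockKernel_eq_zero hJ' hy' z)]
        simp
    simp only [chainSum, Finset.mul_sum, id]
    rw [Finset.sum_comm, Finset.sum_congr rfl h1, Finset.sum_comm]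
    refine Finset.sum_congr rfl fun x hx => ?_
    rw [← Finset.mul_sum, sum_detOn_mul_chainSum hq hJ' (Finset.mem_finsupp_iff.1 hx).2 hn hn'
      le_rfl (by omega), hw]
    split_ifs <;> ring

end Transfer

/-! ### The diagonals of a skew Young diagram -/

section Diagram

theorem exists_notMem_diagonal (Y : YoungDiagram) (p : ℤ) :
    ∃ j : ℕ, 0 ≤ j + p ∧ (((j : ℤ) + p).toNat, j) ∉ Y := by
  by_contra! h
  have h1 : Set.InjOn (fun j : ℕ => (((j : ℤ) + p).toNat, j)) (Set.Ici (-p).toNat) :=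
    fun a _ b _ hab => congrArg Prod.snd hab
  refine (Set.infinite_of_injOn_mapsTo h1 (t := (Y.cells : Set (ℕ × ℕ))) (fun j hj => ?_)
    (Set.Ici_infinite _)) Y.cells.finite_toSet
  rw [Set.mem_Ici] at hj
  exact h j (by omega)

open scoped Classical in
/-- The first column in which the line `i - j = p` runs outside the Young diagram `Y`, among the
columns in which the row index `j + p` is not negative. -/
noncomputable def boundary (Y : YoungDiagram) (p : ℤ) : ℕ := Nat.find (exists_notMem_diagonal Y p)

theorem boundary_nonneg (Y : YoungDiagram) (p : ℤ) : 0 ≤ boundary Y p + p := by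
  classical exact (Nat.find_spec (exists_notMem_diagonal Y p)).1

theorem mem_iff_lt_boundary (Y : YoungDiagram) {p : ℤ} {i j : ℕ} (h : (i : ℤ) = j + p) :
    (i, j) ∈ Y ↔ j < boundary Y p := by
  classical
  have hi : ((j : ℤ) + p).toNat = i := by omega
  constructor
  · intro hY
    by_contra hj
    refine (Nat.find_spec (exists_notMem_diagonal Y p)).2 (Y.up_left_mem ?_ (not_lt.1 hj) hY)
    have : (boundary Y p : ℤ) ≤ j := by omega
    change ((boundary Y p : ℤ) + p).toNat ≤ i
    omega
  · intro hj
    have := Nat.find_min (exists_notMem_diagonal Y p) hj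
    rw [hi] at this
    by_contra hY
    exact this ⟨by omega, hY⟩

theorem boundary_succ_le (Y : YoungDiagram) (p : ℤ) : boundary Y (p + 1) ≤ boundary Y p := by
  have h0 := boundary_nonneg Y p
  by_contra! h
  have h1 := (mem_iff_lt_boundary Y (p := p + 1) (i := ((boundary Y p : ℤ) + p).toNat + 1)
    (j := boundary Y p) (by push_cast; omega)).2 h
  exact lt_irrefl _ ((mem_iff_lt_boundary Y (p := p) (i := ((boundary Y p : ℤ) + p).toNat)
    (j := boundary Y p) (by omega)).1 (Y.up_left_mem (Nat.le_succ _) le_rfl h1))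

theorem boundary_le_succ (Y : YoungDiagram) (p : ℤ) : boundary Y p ≤ boundary Y (p + 1) + 1 := by
  have h0 := boundary_nonneg Y (p + 1)
  by_contra! h
  have h1 := (mem_iff_lt_boundary Y (p := p) (i := ((boundary Y (p + 1) : ℤ) + (p + 1)).toNat)
    (j := boundary Y (p + 1) + 1) (by push_cast; omega)).2 h
  exact lt_irrefl _ ((mem_iff_lt_boundary Y (p := p + 1)
    (i := ((boundary Y (p + 1) : ℤ) + (p + 1)).toNat)
    (j := boundary Y (p + 1)) (by omega)).1 (Y.up_left_mem le_rfl (Nat.le_succ _) h1))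

theorem boundary_mono {Y Z : YoungDiagram} (h : Y ≤ Z) (p : ℤ) : boundary Y p ≤ boundary Z p := by
  have h0 := boundary_nonneg Z p
  by_contra! h'
  have h1 := (mem_iff_lt_boundary Y (p := p) (i := ((boundary Z p : ℤ) + p).toNat)
    (j := boundary Z p) (by omega)).2 h'
  exact lt_irrefl _ ((mem_iff_lt_boundary Z (p := p) (i := ((boundary Z p : ℤ) + p).toNat)
    (j := boundary Z p) (by omega)).1 (h h1))

namespace SkewYoungDiagram

variable (D : SkewYoungDiagram)

theorem mem_cells {c : ℕ × ℕ} : c ∈ D.cells ↔ c ∈ D.outer ∧ c ∉ D.inner := by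
  rw [cells, Finset.mem_sdiff, YoungDiagram.mem_cells, YoungDiagram.mem_cells]

theorem J_eq_Ico (p : ℤ) : D.J p = Finset.Ico (boundary D.inner p) (boundary D.outer p) := by
  ext j
  rw [mem_J, Finset.mem_Ico]
  constructor
  · rintro ⟨i, h, hi⟩
    rw [mem_cells, mem_iff_lt_boundary _ hi, mem_iff_lt_boundary _ hi] at h
    omega
  · intro h
    have h0 := boundary_nonneg D.inner p
    have hi : ((((j : ℤ) + p).toNat : ℕ) : ℤ) = j + p := by omega
    refine ⟨((j : ℤ) + p).toNat, ?_, hi⟩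
    rw [mem_cells, mem_iff_lt_boundary _ hi, mem_iff_lt_boundary _ hi]
    omega

theorem interlaced_J (p : ℤ) : Interlaced (D.J p) (D.J (p + 1)) :=
  ⟨_, _, _, _, D.J_eq_Ico p, D.J_eq_Ico (p + 1), boundary_succ_le _ _, boundary_le_succ _ _,
    boundary_succ_le _ _, boundary_le_succ _ _, boundary_mono D.inner_le_outer _,
    boundary_mono D.inner_le_outer _⟩

theorem mem_contents {p : ℤ} : p ∈ D.contents ↔ (D.J p).Nonempty := by
  rw [J, Finset.image_nonempty, diagonal, Finset.filter_nonempty_iff, contents, Finset.mem_image]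

theorem J_eq_empty {p : ℤ} (h : p ∉ D.contents) : D.J p = ∅ := by
  rwa [mem_contents, Finset.not_nonempty_iff_eq_empty] at h

theorem snd_mem_J {c : ℕ × ℕ} (hc : c ∈ D.cells) : c.2 ∈ D.J (content c) :=
  mem_J.2 ⟨c.1, hc, by simp [content]⟩

theorem mem_cells_of_le {a b c : ℕ × ℕ} (ha : a ∈ D.cells) (hc : c ∈ D.cells) (hab : a ≤ b)
    (hbc : b ≤ c) : b ∈ D.cells := by
  rw [mem_cells] at *
  exact ⟨D.outer.up_left_mem hbc.1 hbc.2 hc.1, fun h => ha.2 (D.inner.up_left_mem hab.1 hab.2 h)⟩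

/-- A tableau is semistandard as soon as its entries on neighbouring diagonals interlace. -/
theorem isSemistandard_iff {T : ℕ × ℕ → ℕ} {G : ℤ × ℕ → ℕ}
    (hT : ∀ c ∈ D.cells, T c = G (content c, c.2)) :
    D.IsSemistandard T ↔
      ∀ p, StrictRel (D.J p) (D.J (p + 1)) (Function.curry G p) (Function.curry G (p + 1)) := by
  constructor
  · rintro ⟨hr, hc⟩ p
    constructor
    · intro j h1 h2
      obtain ⟨i, hi, hip⟩ := mem_J.1 h1
      obtain ⟨i', hi', hip'⟩ := mem_J.1 h2
      have := hc i i' j (by omega) hi hi'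
      rw [hT _ hi, hT _ hi', content, content] at this
      simp only at this
      rwa [show (i : ℤ) - j = p by omega, show (i' : ℤ) - j = p + 1 by omega] at this
    · intro j h1 h2
      obtain ⟨i, hi, hip⟩ := mem_J.1 h1
      obtain ⟨i', hi', hip'⟩ := mem_J.1 h2
      obtain rfl : i = i' := by push_cast at hip; omega
      have := hr i j (j + 1) (by omega) hi' hi
      rw [hT _ hi, hT _ hi', content, content] at this
      simp only at this
      rwa [show (i : ℤ) - j = p + 1 by omega, show (i : ℤ) - (j + 1 : ℕ) = p by omega] at this
  · intro h
    constructor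
    · intro i j j' hjj' h1 h2
      have key : ∀ b, j ≤ b → b ≤ j' → T (i, j) ≤ T (i, b) := by
        intro b hb
        induction b, hb using Nat.le_induction with
        | base => exact fun _ => le_rfl
        | succ b hb ih =>
          intro hb'
          have c1 := D.mem_cells_of_le (b := (i, b)) h1 h2 ⟨le_rfl, hb⟩ ⟨le_rfl, by simp; omega⟩
          have c2 := D.mem_cells_of_le (b := (i, b + 1)) h1 h2 ⟨le_rfl, by simp; omega⟩
            ⟨le_rfl, hb'⟩
          refine (ih (by omega)).trans ?_
          have := (h (content (i, b + 1))).2 b (D.snd_mem_J c2)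
          have e : content (i, b + 1) + 1 = content (i, b) := by simp [content]; ring
          rw [e] at this
          rw [hT _ c1, hT _ c2]
          exact this (D.snd_mem_J c1)
      exact key j' hjj'.le le_rfl
    · intro i i' j hii' h1 h2
      have key : ∀ b, i + 1 ≤ b → b ≤ i' → T (i, j) < T (b, j) := by
        have step : ∀ b, i ≤ b → b + 1 ≤ i' → T (b, j) < T (b + 1, j) := by
          intro b hb hb'
          have c1 := D.mem_cells_of_le (b := (b, j)) h1 h2 ⟨hb, le_rfl⟩ ⟨by simp; omega, le_rfl⟩
          have c2 := D.mem_cells_of_le (b := (b + 1, j)) h1 h2 ⟨by simp; omega, le_rfl⟩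
            ⟨hb', le_rfl⟩
          have := (h (content (b, j))).1 j (D.snd_mem_J c1)
          have e : content (b, j) + 1 = content (b + 1, j) := by simp [content]; ring
          rw [e] at this
          rw [hT _ c1, hT _ c2]
          exact this (D.snd_mem_J c2)
        intro b hb
        induction b, hb using Nat.le_induction with
        | base => exact step i le_rfl
        | succ b hb ih => exact fun hb' => (ih (by omega)).trans (step b (by omega) hb')
      exact key i' hii' le_rfl

end SkewYoungDiagram

end Diagram

/-! ### The transport of the tableau sum into the `q♭`-sum -/

section Transport

open scoped Classical

theorem chainSum_congr {K α β : Type*} [CommRing K] (V : Finset ℕ) (X : α → Finset β)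
    {Φ Ψ : α → (β → ℕ) → (β → ℕ) → K} (e : ℕ → α) (L : ℕ) {t : ℕ}
    (h : ∀ s, t ≤ s → Φ (e s) = Ψ (e s)) (x : β → ℕ) :
    chainSum V X Φ e L t x = chainSum V X Ψ e L t x := by
  induction L generalizing t x with
  | zero => rw [chainSum, chainSum, h t le_rfl]
  | succ L ih =>
    rw [chainSum, chainSum, h t le_rfl]
    exact Finset.sum_congr rfl fun y _ => by rw [ih fun s hs => h s (by omega)]

theorem sum_finsupp_reindex {K ι κ : Type*} [CommRing K] (V : Finset ℕ) {A : Finset ι}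
    {B : Finset κ} (a : ι → κ) (b : κ → ι) (ha : ∀ i ∈ A, a i ∈ B) (hb : ∀ k ∈ B, b k ∈ A)
    (hab : ∀ i ∈ A, b (a i) = i) (hba : ∀ k ∈ B, a (b k) = k) (F : (ι → ℕ) → K) :
    ∑ f ∈ A.finsupp (fun _ => V), F f =
      ∑ g ∈ B.finsupp (fun _ => V), F (fun i => if i ∈ A then g (a i) else 0) := by
  refine Finset.sum_bij' (fun f _ => Finsupp.indicator B fun k _ => f (b k))
    (fun g _ => Finsupp.indicator A fun i _ => g (a i)) ?_ ?_ ?_ ?_ ?_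
  · intro f hf
    rw [Finset.mem_finsupp_iff] at hf ⊢
    refine ⟨Finsupp.support_indicator_subset _ _, fun k hk => ?_⟩
    rw [Finsupp.indicator_of_mem hk]
    exact hf.2 _ (hb k hk)
  · intro g hg
    rw [Finset.mem_finsupp_iff] at hg ⊢
    refine ⟨Finsupp.support_indicator_subset _ _, fun i hi => ?_⟩
    rw [Finsupp.indicator_of_mem hi]
    exact hg.2 _ (ha i hi)
  · intro f hf
    rw [Finset.mem_finsupp_iff] at hf
    ext i
    by_cases hi : i ∈ A
    · simp [Finsupp.indicator_apply, hi, ha, hab]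
    · simp [Finsupp.indicator_apply, hi, eq_zero_of_support_subset hf.1 hi]
  · intro g hg
    rw [Finset.mem_finsupp_iff] at hg
    ext k
    by_cases hk : k ∈ B
    · simp [Finsupp.indicator_apply, hk, hb, hba]
    · simp [Finsupp.indicator_apply, hk, eq_zero_of_support_subset hg.1 hk]
  · intro f hf
    rw [Finset.mem_finsupp_iff] at hf
    congr 1
    funext i
    by_cases hi : i ∈ A
    · simp [Finsupp.indicator_apply, hi, ha, hab]
    · simp [hi, eq_zero_of_support_subset hf.1 hi]

variable {K : Type*} [Field K] (q : K) (N : ℕ) (D : SkewYoungDiagram)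

/-- The length of the chain of tuples on the diagonal `p`: it is `k_p`, except that it is set
to `1` on the empty diagonals. -/
def chainLength (k : ℕ × ℕ → ℕ) (p : ℤ) : ℕ := D.diagValue k p - 1 + 1

/-- The entries of the chain of tuples on the diagonal `p`. -/
def chainIndex (k : ℕ × ℕ → ℕ) (p : ℤ) : Finset (ℕ × ℕ) :=
  Finset.Icc 1 (chainLength D k p) ×ˢ D.J p

/-- The weight of a tableau on the diagonal `p`, and the relation to the next diagonal. -/
noncomputable def tableauKernel (k : ℕ × ℕ → ℕ) (p : ℤ) (x y : ℕ → ℕ) : K :=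
  if StrictRel (D.J p) (D.J (p + 1)) x y then
    ∏ j ∈ D.J p, q ^ ((chainLength D k p - 1) * x j) / qInt q (x j) ^ chainLength D k p else 0

/-- The weight of a chain of tuples on the diagonal `p`, the relations in the chain, and the
relation to the first tuple on the next diagonal. -/
noncomputable def flatKernel (k : ℕ × ℕ → ℕ) (p : ℤ) (z z' : ℕ × ℕ → ℕ) : K :=
  if (∀ l, 1 ≤ l → l < chainLength D k p →
      WeakRel (D.J p) (D.J p) (Function.curry z l) (Function.curry z (l + 1))) ∧
    StrictRel (D.J p) (D.J (p + 1)) (Function.curry z (chainLength D k p)) (Function.curry z' 1) then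
    (∏ j ∈ D.J p, 1 / qInt q (N - z (1, j))) * ∏ l ∈ Finset.Icc 2 (chainLength D k p),
      ∏ j ∈ D.J p, q ^ z (l, j) / qInt q (z (l, j)) else 0

variable {D} in
theorem flatKernel_eq_zero {k : ℕ × ℕ → ℕ} {p : ℤ} {z : ℕ × ℕ → ℕ}
    (hz : ¬ StepMono (D.J p) (Function.curry z 1)) (z' : ℕ × ℕ → ℕ) :
    flatKernel q N D k p z z' = 0 := by
  rw [flatKernel, if_neg]
  rintro ⟨h1, h2⟩
  by_cases h : chainLength D k p = 1
  · rw [h] at h2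
    exact hz (h2.stepMono_left (D.interlaced_J p))
  · exact hz (h1 1 le_rfl (by unfold chainLength at *; omega)).stepMono_left

/-- The sum over the chains of tuples on the diagonal `p`, as a transfer matrix product over the
position in the chain. -/
theorem sum_chainIndex (k : ℕ × ℕ → ℕ) (p : ℤ) (z' : ℕ × ℕ → ℕ) (G : (ℕ → ℕ) → K) :
    ∑ z ∈ (chainIndex D k p).finsupp (fun _ => Finset.Icc 1 (N - 1)),
      G (Function.curry z 1) * flatKernel q N D k p z z' =
    ∑ x ∈ (D.J p).finsupp (fun _ => Finset.Icc 1 (N - 1)), G x *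
      chainSum (Finset.Icc 1 (N - 1)) (fun _ => D.J p) (blockKernel q N (D.J p) (D.J (p + 1))
        (chainLength D k p) (Function.curry z' 1)) id (chainLength D k p - 1) 1 x := by
  obtain ⟨d, hd⟩ : ∃ d, chainLength D k p = d + 1 := ⟨_, rfl⟩
  rw [chainIndex]
  simp only [flatKernel]
  rw [hd, Nat.add_sub_cancel]
  -- A fictitious position `0` in the chain carries the factor `G` of the first tuple.
  have key := chainSum_eq_sum (Finset.Icc 1 (N - 1)) (fun _ : ℕ => D.J p)
    (fun l x y => if l = 0 then G y else blockKernel q N (D.J p) (D.J (p + 1)) (d + 1)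
      (Function.curry z' 1) l x y) Function.injective_id (d + 1) 0 0
  have hl : layers (fun _ : ℕ => D.J p) ((Finset.Ico (0 + 1) (0 + 1 + (d + 1))).image id) =
      Finset.Icc 1 (d + 1) ×ˢ D.J p := by
    ext c
    rw [mem_layers, Finset.image_id, Finset.mem_product, Finset.mem_Ico, Finset.mem_Icc]
    constructor <;> rintro ⟨h1, h2⟩ <;> exact ⟨by omega, h2⟩
  rw [hl, chainSum] at key
  trans ∑ x ∈ (D.J p).finsupp (fun _ => Finset.Icc 1 (N - 1)), G x *
      chainSum (Finset.Icc 1 (N - 1)) (fun _ => D.J p) (fun l x y => if l = 0 then G y else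
        blockKernel q N (D.J p) (D.J (p + 1)) (d + 1) (Function.curry z' 1) l x y) id d 1 x
  · refine Eq.trans (Finset.sum_congr rfl fun z _ => ?_) key.symm
    simp only [id, if_true]
    congr 1
    have h1 : ∀ s ∈ Finset.Ico (0 + 1) (0 + 1 + (d + 1)), (if s = 0 then G (Function.curry z (s + 1))
        else blockKernel q N (D.J p) (D.J (p + 1)) (d + 1) (Function.curry z' 1) s
          (Function.curry z s) (Function.curry z (s + 1))) =
        if (if s < d + 1 then WeakRel (D.J p) (D.J p) (Function.curry z s) (Function.curry z (s + 1))
          else StrictRel (D.J p) (D.J (p + 1)) (Function.curry z s) (Function.curry z' 1)) then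
        ∏ j ∈ D.J p, (if s = 1 then 1 / qInt q (N - z (s, j)) else
          q ^ z (s, j) / qInt q (z (s, j))) else 0 := by
      intro s hs
      rw [Finset.mem_Ico] at hs
      rw [if_neg (by omega)]
      rfl
    rw [Finset.prod_congr rfl h1, Finset.prod_ite_zero]
    refine if_ctx_congr ?_ (fun _ => ?_) fun _ => rfl
    · simp only [Finset.mem_Ico]
      constructor
      · rintro ⟨h2, h3⟩ s hs
        split_ifs with h4
        · exact h2 s (by omega) h4
        · obtain rfl : s = d + 1 := by omega
          exact h3
      · intro h
        constructor
        · intro l h2 h3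
          have := h l (by omega)
          rwa [if_pos h3] at this
        · have := h (d + 1) (by omega)
          rwa [if_neg (lt_irrefl _)] at this
    · rw [show Finset.Ico (0 + 1) (0 + 1 + (d + 1)) = insert 1 (Finset.Icc 2 (d + 1)) by
        ext; simp only [Finset.mem_Ico, Finset.mem_insert, Finset.mem_Icc]; omega,
        Finset.prod_insert (by simp)]
      simp only [if_true]
      congr 1
      refine Finset.prod_congr rfl fun l hl => ?_
      rw [Finset.mem_Icc] at hl
      simp only [show l ≠ 1 by omega, if_false]
  · refine Finset.sum_congr rfl fun x _ => ?_
    congr 1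
    refine chainSum_congr _ _ _ _ (fun s hs => ?_) _
    funext x y
    simp only [id, show s ≠ 0 by omega, if_false]

variable {q N}

/-- The transport of the whole sum: the sum over the tableau entries after the diagonal `e t`,
for the given entries `m` on it, equals the sum over the chains of tuples after this diagonal,
coupled to `m` by the transfer kernel. -/
theorem chainSum_tableauKernel (hq : ∀ n : ℕ, 0 < n → n < N → qInt q n ≠ 0) (k : ℕ × ℕ → ℕ)
    {e : ℕ → ℤ} (he : ∀ t, e (t + 1) = e t + 1) {L t : ℕ} (hL : D.J (e (t + 1 + L)) = ∅)
    {m : ℕ → ℕ} (hm : ∀ j ∈ D.J (e t), m j ∈ Finset.Icc 1 (N - 1))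
    (hm' : StepMono (D.J (e t)) m) :
    chainSum (Finset.Icc 1 (N - 1)) D.J (tableauKernel q D k) e (L + 1) t m =
      (∏ j ∈ D.J (e t), q ^ ((chainLength D k (e t) - 1) * m j) /
        qInt q (m j) ^ chainLength D k (e t)) *
      ∑ y ∈ (chainIndex D k (e (t + 1))).finsupp (fun _ => Finset.Icc 1 (N - 1)),
        transfer q N (D.J (e t)) (D.J (e (t + 1))) m (Function.curry y 1) *
          chainSum (Finset.Icc 1 (N - 1)) (chainIndex D k) (flatKernel q N D k) e L (t + 1) y := by
  have hint : ∀ t, Interlaced (D.J (e t)) (D.J (e (t + 1))) := fun t => by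
    rw [he]; exact D.interlaced_J _
  induction L generalizing t m with
  | zero =>
    have hJ : D.J (e (t + 1)) = ∅ := hL
    have h0 : ∀ {γ : Type} (s : Finset γ), s = ∅ →
        s.finsupp (fun _ => Finset.Icc 1 (N - 1)) = {0} := by
      rintro γ s rfl
      ext f
      simp [Finset.mem_finsupp_iff]
    have hX : chainIndex D k (e (t + 1)) = ∅ := by rw [chainIndex, hJ, Finset.product_empty]
    rw [chainSum, h0 _ hJ, h0 _ hX, Finset.sum_singleton, Finset.sum_singleton, chainSum, chainSum,
      transfer_eq hq (hint t) hm (by simp [hJ]), hJ, detOn_empty, tableauKernel, tableauKernel,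
      flatKernel, ← he, hJ]
    simp [StrictRel, WeakRel]
  | succ L ih =>
    set w := ∏ j ∈ D.J (e t), q ^ ((chainLength D k (e t) - 1) * m j) /
        qInt q (m j) ^ chainLength D k (e t) with hw
    rw [chainSum]
    have h1 : ∀ x ∈ (D.J (e (t + 1))).finsupp (fun _ => Finset.Icc 1 (N - 1)),
        tableauKernel q D k (e t) m x *
          chainSum (Finset.Icc 1 (N - 1)) D.J (tableauKernel q D k) e (L + 1) (t + 1) x =
        w * ∑ y ∈ (chainIndex D k (e (t + 1 + 1))).finsupp (fun _ => Finset.Icc 1 (N - 1)),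
          (if StrictRel (D.J (e t)) (D.J (e (t + 1))) m x then
            (∏ j ∈ D.J (e (t + 1)), q ^ ((chainLength D k (e (t + 1)) - 1) * x j) /
              qInt q (x j) ^ (chainLength D k (e (t + 1)) - 1 + 1)) *
            transfer q N (D.J (e (t + 1))) (D.J (e (t + 1 + 1))) x (Function.curry y 1) else 0) *
          chainSum (Finset.Icc 1 (N - 1)) (chainIndex D k) (flatKernel q N D k) e L
            (t + 1 + 1) y := by
      intro x hx
      rw [tableauKernel, ← he]
      split_ifs with h
      · rw [ih (by rw [← hL]; congr 2; omega) (Finset.mem_finsupp_iff.1 hx).2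
          (h.stepMono_right (hint t)), Finset.mul_sum]
        simp only [mul_assoc]
        rfl
      · simp
    rw [Finset.sum_congr rfl h1, ← Finset.mul_sum, Finset.sum_comm]
    congr 1
    simp only [chainSum, Finset.mul_sum]
    rw [Finset.sum_comm (s := (chainIndex D k (e (t + 1))).finsupp _)]
    refine Finset.sum_congr rfl fun y hy => ?_
    simp only [← mul_assoc, ← Finset.sum_mul]
    by_cases hy' : StepMono (D.J (e (t + 1 + 1))) (Function.curry y 1)
    · congr 1
      have h2 := sum_chainIndex q N D k (e (t + 1)) y
        (transfer q N (D.J (e t)) (D.J (e (t + 1))) m)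
      rw [← he] at h2
      rw [h2]
      have h3 := sum_transfer_mul_chainSum hq (hint t) (hint (t + 1)) hm hm'
        (n := Function.curry y 1) (fun j hj => (Finset.mem_finsupp_iff.1 hy).2 (1, j) ?_) hy'
        (chainLength D k (e (t + 1)) - 1)
      · exact h3.symm
      · rw [chainIndex, Finset.mem_product, Finset.mem_Icc]
        exact ⟨⟨le_rfl, by simp [chainLength]⟩, hj⟩
    · rw [chainSum_eq_zero (fun z => flatKernel_eq_zero q N hy' z), mul_zero, mul_zero]

variable (q N)

/-- The tableau sum as a sum over families indexed by content and column. -/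
theorem zetaBZ_eq_sum {k : ℕ × ℕ → ℕ} (hk : D.IsIndex k) (hdiag : D.IsDiagonallyConstant k)
    {S : Finset ℤ} (hS : D.contents ⊆ S) :
    zetaBZ q D k N = ∑ g ∈ (layers D.J S).finsupp (fun _ => Finset.Icc 1 (N - 1)),
      ∏ p ∈ S, tableauKernel q D k p (Function.curry g p) (Function.curry g (p + 1)) := by
  have hmem : ∀ c ∈ D.cells, (SkewYoungDiagram.content c, c.2) ∈ layers D.J S := fun c hc =>
    mem_layers.2 ⟨hS (Finset.mem_image_of_mem _ hc), D.snd_mem_J hc⟩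
  have hmem' : ∀ c ∈ layers D.J S, (((c.2 : ℤ) + c.1).toNat, c.2) ∈ D.cells ∧
      SkewYoungDiagram.content (((c.2 : ℤ) + c.1).toNat, c.2) = c.1 := by
    intro c hc
    obtain ⟨i, hi, h⟩ := SkewYoungDiagram.mem_J.1 (mem_layers.1 hc).2
    rw [← h, Int.toNat_natCast]
    exact ⟨hi, by rw [SkewYoungDiagram.content]; simp only; omega⟩
  rw [zetaBZ, SkewYoungDiagram.ssyt, Finset.sum_filter,
    sum_finsupp_reindex (Finset.Icc 1 (N - 1)) (B := layers D.J S)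
      (fun c => (SkewYoungDiagram.content c, c.2)) (fun c => (((c.2 : ℤ) + c.1).toNat, c.2))
      hmem (fun c hc => (hmem' c hc).1) (fun c _ => by simp [SkewYoungDiagram.content])
      (fun c hc => by rw [(hmem' c hc).2]) (fun T => if D.IsSemistandard T then
        ∏ c ∈ D.cells, q ^ ((k c - 1) * T c) / qInt q (T c) ^ k c else 0)]
  refine Finset.sum_congr rfl fun g _ => ?_
  simp only [tableauKernel]
  rw [Finset.prod_ite_zero]
  refine if_ctx_congr ?_ (fun _ => ?_) fun _ => rfl
  · rw [D.isSemistandard_iff (G := g) (fun c hc => by rw [if_pos hc])]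
    refine ⟨fun h p _ => h p, fun h p => ?_⟩
    by_cases hp : p ∈ S
    · exact h p hp
    · simp [StrictRel, D.J_eq_empty fun h => hp (hS h)]
  · have h1 : ∏ p ∈ S, ∏ j ∈ D.J p, q ^ ((chainLength D k p - 1) * Function.curry g p j) /
        qInt q (Function.curry g p j) ^ chainLength D k p =
        ∏ c ∈ layers D.J S, q ^ ((chainLength D k c.1 - 1) * g c) /
          qInt q (g c) ^ chainLength D k c.1 := by
      rw [← Finset.prod_finset_product' (layers D.J S) S D.J (fun c => mem_layers)]
      rfl
    rw [h1]
    refine Finset.prod_bij' (fun c _ => (SkewYoungDiagram.content c, c.2))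
      (fun c _ => (((c.2 : ℤ) + c.1).toNat, c.2)) hmem (fun c hc => (hmem' c hc).1)
      (fun c _ => by simp [SkewYoungDiagram.content]) (fun c hc => by rw [(hmem' c hc).2]) ?_
    intro c hc
    have : chainLength D k (SkewYoungDiagram.content c) = k c := by
      rw [chainLength, SkewYoungDiagram.diagValue_content hdiag hc]
      exact Nat.sub_add_cancel (hk c hc)
    rw [this, if_pos hc]

/-- The `q♭`-sum as a sum over families of chains, with the conditions moved into the kernels. -/
theorem zetaFlat_eq_sum {k : ℕ × ℕ → ℕ} (hk : D.IsIndex k) (hdiag : D.IsDiagonallyConstant k)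
    {S : Finset ℤ} (hS : D.contents ⊆ S) :
    zetaFlat q D k N = ∑ g ∈ (layers (chainIndex D k) S).finsupp (fun _ => Finset.Icc 1 (N - 1)),
      ∏ p ∈ S, flatKernel q N D k p (Function.curry g p) (Function.curry g (p + 1)) := by
  have hlen : ∀ p ∈ D.contents, chainLength D k p = D.diagValue k p := by
    intro p hp
    obtain ⟨c, hc, rfl⟩ := Finset.mem_image.1 hp
    rw [chainLength, SkewYoungDiagram.diagValue_content hdiag hc]
    exact Nat.sub_add_cancel (hk c hc)
  have hsupp : flatSupport D k = layers (chainIndex D k) S := by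
    ext ⟨p, l, j⟩
    simp only [flatSupport, mem_layers, chainIndex, Finset.mem_biUnion, Finset.mem_product,
      Finset.mem_singleton]
    constructor
    · rintro ⟨_, hp, rfl, hl, hj⟩
      rw [hlen _ hp]
      exact ⟨hS hp, hl, hj⟩
    · rintro ⟨_, hl, hj⟩
      have hp := D.mem_contents.2 ⟨j, hj⟩
      rw [hlen _ hp] at hl
      exact ⟨p, hp, rfl, hl, hj⟩
  rw [zetaFlat, flatFamilies, Finset.sum_filter, hsupp]
  refine Finset.sum_congr rfl fun g _ => ?_
  simp only [flatKernel]
  rw [Finset.prod_ite_zero]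
  refine if_ctx_congr ?_ (fun _ => ?_) fun _ => rfl
  · constructor
    · rintro ⟨h1, h2⟩ p _
      by_cases hp : p ∈ D.contents
      · rw [hlen p hp]
        exact ⟨h1 p, h2 p⟩
      · simp [StrictRel, WeakRel, D.J_eq_empty hp]
    · intro h
      constructor <;> intro p <;> by_cases hp : p ∈ D.contents
      · have := (h p (hS hp)).1
        rw [hlen p hp] at this
        exact this
      · simp [WeakRel, D.J_eq_empty hp]
      · have := (h p (hS hp)).2
        rw [hlen p hp] at this
        exact this
      · simp [StrictRel, D.J_eq_empty hp]
  · rw [← Finset.prod_subset hS]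
    · refine Finset.prod_congr rfl fun p hp => ?_
      rw [hlen p hp]
      rfl
    · intro p _ hp
      simp [D.J_eq_empty hp]

theorem zetaBZ_eq_zetaFlat {K : Type*} [Field K] {q : K} {N : ℕ}
    (hq : ∀ n : ℕ, 0 < n → n < N → qInt q n ≠ 0)
    (D : SkewYoungDiagram) {k : ℕ × ℕ → ℕ} (hk : D.IsIndex k)
    (hdiag : D.IsDiagonallyConstant k) :
    zetaBZ q D k N = zetaFlat q D k N := by
  classical
  obtain ⟨B, hB⟩ : ∃ B : ℕ, ∀ p ∈ D.contents, p.natAbs < B :=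
    ⟨D.contents.sup Int.natAbs + 1, fun p hp =>
      Nat.lt_succ_of_le (Finset.le_sup (f := Int.natAbs) hp)⟩
  -- The diagonals `-B` and `B + 1` at the two ends are empty.
  let e : ℕ → ℤ := fun t => (t : ℤ) - B
  have he : ∀ t, e (t + 1) = e t + 1 := fun t => by simp only [e]; push_cast; ring
  have hinj : Function.Injective e := fun a b h => by simp only [e] at h; omega
  have hS : D.contents ⊆ (Finset.Ico (0 + 1) (0 + 1 + (2 * B + 1))).image e := by
    intro p hp
    have := hB p hp
    refine Finset.mem_image.2 ⟨(p + B).toNat, Finset.mem_Ico.2 (by omega), ?_⟩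
    simp only [e]
    omega
  have h0 : D.J (e 0) = ∅ := D.J_eq_empty fun h => by
    have := hB _ h
    simp only [e] at this
    omega
  have h1 : D.J (e (0 + 1 + 2 * B)) = ∅ := D.J_eq_empty fun h => by
    have := hB _ h
    simp only [e] at this
    omega
  have hT := chainSum_eq_sum (Finset.Icc 1 (N - 1)) D.J (tableauKernel q D k) hinj (2 * B + 1) 0 0
  have hF := chainSum_eq_sum (Finset.Icc 1 (N - 1)) (chainIndex D k) (flatKernel q N D k) hinj
    (2 * B + 1) 0 0
  have hT0 : ∀ y, tableauKernel q D k (e 0) 0 y = 1 := fun y => by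
    simp [tableauKernel, h0, StrictRel]
  have hF0 : ∀ y, flatKernel q N D k (e 0) 0 y = 1 := fun y => by
    simp [flatKernel, h0, StrictRel, WeakRel]
  rw [zetaBZ_eq_sum q N D hk hdiag hS, zetaFlat_eq_sum q N D hk hdiag hS]
  simp only [Finset.prod_image hinj.injOn, ← he]
  simp only [hT0, one_mul] at hT
  simp only [hF0, one_mul] at hF
  rw [← hT, ← hF, chainSum_tableauKernel D hq k he h1 (by simp [h0]) (by simp [StepMono, h0]),
    chainSum]
  rw [h0, Finset.prod_empty, one_mul]
  refine Finset.sum_congr rfl fun y _ => ?_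
  rw [hF0, transfer, detDiff, detOn_empty]

end Transport

end SchurMSW

/-- The Schur type MSW formula for `q`-sums. The element `q` may be any element of a field
for which the denominators `[1]_q, …, [N-1]_q` do not vanish. -/
theorem theorem1p5 {K : Type*} [Field K] (q : K) (N : ℕ) (hN : 0 < N)
    (hq : ∀ n : ℕ, 0 < n → n < N → SchurMSW.qInt q n ≠ 0)
    (D : SchurMSW.SkewYoungDiagram) (k : ℕ × ℕ → ℕ) (hk : D.IsIndex k)
    (hdiag : D.IsDiagonallyConstant k) :
    SchurMSW.zetaBZ q D k N = SchurMSW.zetaFlat q D k N :=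
  SchurMSW.zetaBZ_eq_zetaFlat hq D hk hdiag
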